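/- **Setting.** Let $f:\mathbb R^n\to\mathbb R$ and $g:\mathbb R^n\to\mathbb R^m$ be smooth ($C^1$ suffices), $\mu>0$ fixed, and consider the barrier problem $$\min_{x,\;y>0}\ f(x)-\mu\sum_{i=1}^m\ln y^{(i)}\quad\text{subject to}\quad g(x)+y=0 .$$ $\|\cdot\|$ is the Euclidean norm (operator norm for matrices), $A(x)=(\nabla g^{(1)}(x),\dots,\nabla g^{(m)}(x))$, $\nabla f_k=\nabla f(x_k)$, $g_k=g(x_k)$, $A_k=A(x_k)$, $c_k=g_k+y_k$, $Y_k=\mathrm{diag}(y_k)$, $e=(1,\dots,1)^T$, and $D_kd=(d_x,\,Y_k^{-1}d_y)$ for $d=(d_x,d_y)\in\mathbb R^n\times\mathbb R^m$. **The inner loop of ARCBIP.** Constants: $0<\eta_1\le\eta_2<1$, $1<\gamma_1<\gamma_2$, $\xi,\delta,\tau\in(0,1)$, $\gamma_n,\gamma_t>0$. Starting data: $x_0$, $y_0>0$, $\nu_{-1}>0$, $\sigma_0>0$. An infinite sequence of iterates is generated, where for each $k$: $\sigma_k>0$, $\tilde\sigma_k=\sigma_k/\xi^3$; $B_k$ is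 a symmetric $n\times n$ matrix (the Hessian $\nabla^2_{xx}$ of the Lagrangian or an approximation); and $N_k=\binom{N_x}{N_y}$ is an $(n+m)\times n$ matrix whose columns form a basis of the null space of $(A_k^T\ I)$. 1. *Normal step.* With $$\mathrm{npred}_k(d)=\|c_k\|-\|c_k+A_k^Td_x+d_y\|-\tfrac13\tilde\sigma_k\|D_kd\|^3 ,\qquad n_k^c=-\begin{pmatrix}A_k\\Y_k^2\end{pmatrix}c_k ,$$ the step $n_k=(n_x,n_y)$ satisfies $n_y\ge-\xi\tau y_k$ and: (a) $n_k=\binom{A_k}{Y_k^2}\omega_k$ for some $\omega_k\in\mathbb R^m$ whenever the problem of minimizing $\frac12\|c_k+A_k^Td_x+d_y\|^2+\frac13\tilde\sigma_k\|D_kd\|^3$ subject to $d_y\ge-\xi\tau y_k$ has an optimal solution of that form; (b) $\mathrm{npred}_k(n_k)\ge\gamma_n\,\mathrm{npred}_k(\alpha_k^cn_k^c)$, where $\alpha_k^c$ maximizes $\mathrm{npred}_k(\alpha n_k^c)$ over $\alpha\ge0$ with $\alpha n^c_y\ge-\xi\tau y_k$ ($n^c_y$ is the $y$-block of $n_k^c$).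 2. *Tangential step.* With $$\mathrm{tpred}_k(t)=-(\nabla f_k+B_kn_x)^Tt_x-\tfrac12t_x^TB_kt_x+\mu\big(e^TY_k^{-1}t_y-n_y^TY_k^{-2}t_y-\tfrac12t_y^TY_k^{-2}t_y\big)-\tfrac13\sigma_k\|D_kt\|^3 ,$$ $$p_k^c=-N_x^T(\nabla f_k+B_kn_x)+\mu N_y^T(Y_k^{-1}e-Y_k^{-2}n_y) ,$$ the step $t_k=(t_x,t_y)$ satisfies $A_k^Tt_x+t_y=0$, $n_y+t_y\ge-\tau y_k$ and (c) $\mathrm{tpred}_k(t_k)\ge\gamma_t\,\mathrm{tpred}_k(\beta_k^cN_kp_k^c)$, where $\beta_k^c$ maximizes $\mathrm{tpred}_k(\beta N_kp_k^c)$ over $\beta\ge0$ with $n_y+\beta N_yp_k^c\ge-\tau y_k$. Put $d_k=n_k+t_k$. 3. *Penalty parameter.* With $\chi_k=-\nabla f_k^Tn_x-\frac12n_x^TB_kn_x+\mu(e^TY_k^{-1}n_y-\frac12n_y^TY_k^{-2}n_y)$ and $\Delta_k=\frac13\sigma_k(\|D_kt_k\|^3-\|D_kd_k\|^3)$, let $$\tilde\nu_k=\max\left\{-\frac{\mathrm{tpred}_k(t_k)+\Delta_k+\chi_k}{(1-\delta)\,\mathrm{npred}_k(n_k)+\frac13\tilde\sigma_k\|D_kn_k\|^3},\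 -\frac{\Delta_k}{\frac12\,\mathrm{npred}_k(n_k)+\frac13\tilde\sigma_k\|D_kn_k\|^3}\right\}$$ ($\tilde\nu_k=0$ if $n_k=0$); $\nu_k=\nu_{k-1}$ if $\tilde\nu_k\le\nu_{k-1}$, and $\nu_k=\max\{\tilde\nu_k,\,1.5\,\nu_{k-1}\}$ otherwise. 4. *Acceptance.* Let $\phi(x,y;\nu)=f(x)-\mu\sum_i\ln y^{(i)}+\nu\|g(x)+y\|$, $$m_k(d)=f_k+\nabla f_k^Td_x+\tfrac12d_x^TB_kd_x+\tfrac13\sigma_k\|D_kd\|^3-\mu\Big(\sum_i\ln y_k^{(i)}+e^TY_k^{-1}d_y-\tfrac12d_y^TY_k^{-2}d_y\Big)+\nu_k\|c_k+A_k^Td_x+d_y\| ,$$ and $\rho_k=\dfrac{\phi(x_k,y_k;\nu_k)-\phi(x_k+d_x,y_k+d_y;\nu_k)}{m_k(0)-m_k(d_k)}$, where $d_k=(d_x,d_y)$ and $\rho_k=0$ if the denominator vanishes. If $\rho_k\ge\eta_1$, then $(x_{k+1},y_{k+1})=(x_k,y_k)+d_k$; otherwise $(x_{k+1},y_{k+1})=(x_k,y_k)$.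 5. *Regularisation.* $\sigma_{k+1}\in(0,\sigma_k]$ if $\rho_k\ge\eta_2$; $\sigma_{k+1}\in[\sigma_k,\gamma_1\sigma_k]$ if $\eta_1\le\rho_k<\eta_2$; $\sigma_{k+1}\in[\gamma_1\sigma_k,\gamma_2\sigma_k]$ if $\rho_k<\eta_1$. **Assumptions.** (A1) $f$ and $g$ are differentiable on an open convex set $\mathcal X$ containing all $x_k$, and $\nabla f$, $g$, $A$ are Lipschitz continuous on $\mathcal X$. (A2) The sequence $\{x_k\}$ is infinite, $\{f(x_k)\}$ is bounded below, and $\{\nabla f_k\},\{g_k\},\{A_k\},\{B_k\}$ are bounded. (A3) There is $\gamma_N>0$ with $\|N_k\|\le\gamma_N$ and $\sigma_{\min}(N_k)\ge\gamma_N^{-1}$ for all $k$. **Theorem.** Assume (A1)–(A3), and that the ($m$) singular values of the $m\times(n+m)$ matrices $(A_k^T\ \ Y_k)$ are bounded away from zero, uniformly in $k$. Then $$\nabla f(x_k)+\mu A_kY_k^{-1}e\to0\qquad(k\to\infty).$$ -/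

import Mathlib

open scoped InnerProductSpace

noncomputable section

namespace ARCBIP

/-- Column vectors with the Euclidean norm. -/
abbrev Vec (n : ℕ) := EuclideanSpace ℝ (Fin n)

/-- Block vectors `(d_x; d_y)` with `d_x` of length `n` and `d_y` of length `m`, with the Euclidean
norm of the stacked vector. -/
abbrev Blk (n m : ℕ) := WithLp 2 (Vec n × Vec m)

variable {n m : ℕ}

/-- The stacked vector `(a; b)`. -/
def blk (a : Vec n) (b : Vec m) : Blk n m := WithLp.toLp 2 (a, b)

/-- `A(x) = (∇g⁽¹⁾(x), …, ∇g⁽ᵐ⁾(x))`, as a linear map from `ℝᵐ` to `ℝⁿ`: the transpose of the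
Jacobian of `g`. -/
def conGrad (g : Vec n → Vec m) (x : Vec n) : Vec m →L[ℝ] Vec n :=
  ContinuousLinearMap.adjoint (fderiv ℝ g x)

/-- `v ↦ Y v`, where `Y` is the diagonal matrix with diagonal `y`. -/
def slackDiag (y : Vec m) : Vec m →ₗ[ℝ] Vec m :=
  Matrix.toEuclideanLin (Matrix.diagonal fun i => y i)

/-- The linear map `(Aᵀ Y)` from block vectors to `ℝᵐ`. -/
def scaledJac (A : Vec m →L[ℝ] Vec n) (y : Vec m) : Blk n m →ₗ[ℝ] Vec m :=
  (ContinuousLinearMap.adjoint A).toLinearMap ∘ₗ WithLp.fstₗ 2 ℝ (Vec n) (Vec m) +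
    slackDiag y ∘ₗ WithLp.sndₗ 2 ℝ (Vec n) (Vec m)

/-- The linear map `(Aᵀ I)` from block vectors to `ℝᵐ`. -/
def jac (A : Vec m →L[ℝ] Vec n) : Blk n m →ₗ[ℝ] Vec m :=
  (ContinuousLinearMap.adjoint A).toLinearMap ∘ₗ WithLp.fstₗ 2 ℝ (Vec n) (Vec m) +
    WithLp.sndₗ 2 ℝ (Vec n) (Vec m)

/-- The constants of the algorithm, with `γn` and `γt` the constants of the two Cauchy decrease
conditions. -/
structure Params where
  η₁ : ℝ
  η₂ : ℝ
  γ₁ : ℝ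
  γ₂ : ℝ
  ξ : ℝ
  δ : ℝ
  τ : ℝ
  γn : ℝ
  γt : ℝ
  η₁_pos : 0 < η₁
  η₁_le_η₂ : η₁ ≤ η₂
  η₂_lt_one : η₂ < 1
  one_lt_γ₁ : 1 < γ₁
  γ₁_lt_γ₂ : γ₁ < γ₂
  ξ_pos : 0 < ξ
  ξ_lt_one : ξ < 1
  δ_pos : 0 < δ
  δ_lt_one : δ < 1
  τ_pos : 0 < τ
  τ_lt_one : τ < 1
  γn_pos : 0 < γn
  γt_pos : 0 < γt

/-- The merit function `f(x) - μ ∑ ln y⁽ⁱ⁾ + ν ‖g(x) + y‖`. -/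
def merit (f : Vec n → ℝ) (g : Vec n → Vec m) (μ ν : ℝ) (x : Vec n) (y : Vec m) : ℝ :=
  f x - μ * ∑ i, Real.log (y i) + ν * ‖g x + y‖

/-- The data at one iteration from which the subproblems are built: `∇f_k`, `g_k`, `A_k`, `y_k`,
`B_k`, `σ_k`. -/
structure Local (n m : ℕ) where
  gradf : Vec n
  gval : Vec m
  A : Vec m →L[ℝ] Vec n
  y : Vec m
  B : Vec n →L[ℝ] Vec n
  σ : ℝ

namespace Local

variable (L : Local n m)

/-- `g_k + y_k`. -/
def res : Vec m := L.gval + L.y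

/-- `D_k d = (d_x; Y_k⁻¹ d_y)`. -/
def scale (d : Blk n m) : Blk n m := blk d.fst (WithLp.toLp 2 fun i => d.snd i / L.y i)

/-- `σ̃_k = σ_k / ξ³`. -/
def sigmaTilde (ξ : ℝ) : ℝ := L.σ / ξ ^ 3

/-- Objective of the normal subproblem. -/
def normalObj (ξ : ℝ) (d : Blk n m) : ℝ :=
  1 / 2 * ‖L.res + jac L.A d‖ ^ 2 + 1 / 3 * L.sigmaTilde ξ * ‖L.scale d‖ ^ 3

/-- Feasible set of the normal subproblem: `n_y ≥ -ξ τ y_k`. -/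
def normalFeasible (ξ τ : ℝ) : Set (Blk n m) := {d | ∀ i, -(ξ * τ * L.y i) ≤ d.snd i}

/-- The vectors of the form `(A_k; Y_k²) ω`. -/
def rangeSpace : Set (Blk n m) :=
  {d | ∃ ω : Vec m, d = blk (L.A ω) (WithLp.toLp 2 fun i => L.y i ^ 2 * ω i)}

/-- Range space condition. -/
def RangeSpaceCondition (ξ τ : ℝ) (d : Blk n m) : Prop :=
  (∃ d' ∈ L.normalFeasible ξ τ, IsMinOn (L.normalObj ξ) (L.normalFeasible ξ τ) d' ∧
    d' ∈ L.rangeSpace) → d ∈ L.rangeSpace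

/-- Normal predicted reduction. -/
def npred (ξ : ℝ) (d : Blk n m) : ℝ :=
  ‖L.res‖ - ‖L.res + jac L.A d‖ - 1 / 3 * L.sigmaTilde ξ * ‖L.scale d‖ ^ 3

/-- The scaled steepest descent direction `n_k^c = -(A_k; Y_k²)(g_k + y_k)`. -/
def normalDir : Blk n m :=
  blk (-(L.A L.res)) (WithLp.toLp 2 fun i => -(L.y i ^ 2 * L.res i))

/-- The step lengths allowed along `n_k^c`. -/
def normalLengths (ξ τ : ℝ) : Set ℝ := {α | 0 ≤ α ∧ α • L.normalDir ∈ L.normalFeasible ξ τ}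

/-- Normal Cauchy decrease condition: the normal predicted reduction is at least the fraction `γn`
of the largest one along `n_k^c`. -/
def NormalCauchyDecrease (ξ τ γn : ℝ) (d : Blk n m) : Prop :=
  ∃ α ∈ L.normalLengths ξ τ,
    IsMaxOn (fun β => L.npred ξ (β • L.normalDir)) (L.normalLengths ξ τ) α ∧
    γn * L.npred ξ (α • L.normalDir) ≤ L.npred ξ d

/-- Tangential predicted reduction of `t` after the normal step `d`. -/
def tpred (μ : ℝ) (d t : Blk n m) : ℝ :=
  -⟪L.gradf + L.B d.fst, t.fst⟫_ℝ - 1 / 2 * ⟪t.fst, L.B t.fst⟫_ℝ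
    + μ * (∑ i, t.snd i / L.y i - ∑ i, d.snd i * t.snd i / L.y i ^ 2
        - 1 / 2 * ∑ i, t.snd i ^ 2 / L.y i ^ 2)
    - 1 / 3 * L.σ * ‖L.scale t‖ ^ 3

/-- Feasible set of the tangential subproblem: `A_kᵀ t_x + t_y = 0` and `n_y + t_y ≥ -τ y_k`. -/
def tangFeasible (τ : ℝ) (d : Blk n m) : Set (Blk n m) :=
  {t | jac L.A t = 0 ∧ ∀ i, -(τ * L.y i) ≤ d.snd i + t.snd i}

/-- `p_k^c = -N_xᵀ(∇f_k + B_k n_x) + μ N_yᵀ(Y_k⁻¹ e - Y_k⁻² n_y)`. -/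
def tangDir (μ : ℝ) (N : Vec n →L[ℝ] Blk n m) (d : Blk n m) : Vec n :=
  ContinuousLinearMap.adjoint N
    (blk (-(L.gradf + L.B d.fst))
      (WithLp.toLp 2 fun i => μ * (1 / L.y i - d.snd i / L.y i ^ 2)))

/-- The step lengths allowed along `N_k p_k^c`. -/
def tangLengths (μ τ : ℝ) (N : Vec n →L[ℝ] Blk n m) (d : Blk n m) : Set ℝ :=
  {β | 0 ≤ β ∧ ∀ i, -(τ * L.y i) ≤ d.snd i + (β • N (L.tangDir μ N d)).snd i}

/-- Tangential Cauchy decrease condition. -/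
def TangCauchyDecrease (μ τ γt : ℝ) (N : Vec n →L[ℝ] Blk n m) (d t : Blk n m) : Prop :=
  ∃ β ∈ L.tangLengths μ τ N d,
    IsMinOn (fun b => -L.tpred μ d (b • N (L.tangDir μ N d))) (L.tangLengths μ τ N d) β ∧
    γt * L.tpred μ d (β • N (L.tangDir μ N d)) ≤ L.tpred μ d t

/-- The model `m_k` of the merit function, without the constant `f_k - μ ∑ ln y_k⁽ⁱ⁾`. -/
def model (μ ν : ℝ) (d : Blk n m) : ℝ :=
  ⟪L.gradf, d.fst⟫_ℝ + 1 / 2 * ⟪d.fst, L.B d.fst⟫_ℝ + 1 / 3 * L.σ * ‖L.scale d‖ ^ 3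
    - μ * (∑ i, d.snd i / L.y i - 1 / 2 * ∑ i, d.snd i ^ 2 / L.y i ^ 2)
    + ν * ‖L.res + jac L.A d‖

/-- Predicted reduction in the merit function. -/
def pred (μ ν : ℝ) (d : Blk n m) : ℝ := L.model μ ν 0 - L.model μ ν d

/-- `χ_k`. -/
def chi (μ : ℝ) (d : Blk n m) : ℝ :=
  -⟪L.gradf, d.fst⟫_ℝ - 1 / 2 * ⟪d.fst, L.B d.fst⟫_ℝ
    + μ * (∑ i, d.snd i / L.y i - 1 / 2 * ∑ i, d.snd i ^ 2 / L.y i ^ 2)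

/-- The threshold `ν̃_k` for the penalty parameter, with normal step `d` and tangential step `t`.
(When `d = 0` both quotients are `0 / 0`, read as `0`, so that no increase is requested.) -/
def nuTilde (μ ξ δ : ℝ) (d t : Blk n m) : ℝ :=
  max
    (-((L.tpred μ d t + 1 / 3 * L.σ * (‖L.scale t‖ ^ 3 - ‖L.scale (d + t)‖ ^ 3) + L.chi μ d) /
      ((1 - δ) * L.npred ξ d + 1 / 3 * L.sigmaTilde ξ * ‖L.scale d‖ ^ 3)))
    (-((1 / 3 * L.σ * (‖L.scale t‖ ^ 3 - ‖L.scale (d + t)‖ ^ 3)) /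
      (1 / 2 * L.npred ξ d + 1 / 3 * L.sigmaTilde ξ * ‖L.scale d‖ ^ 3)))

end Local

/-- The update rule of the penalty parameter. -/
def penaltyUpdate (νprev νt : ℝ) : ℝ := if νt ≤ νprev then νprev else max νt (3 / 2 * νprev)

/-- The sequences produced by the algorithm: iterates `(x_k, y_k)`, normal steps `n_k`, tangential
steps `t_k`, penalty parameters `ν_k`, regularisation parameters `σ_k`, matrices `B_k` and null
space bases `N_k`. -/
structure Seqs (n m : ℕ) where
  x : ℕ → Vec n
  y : ℕ → Vec m
  nStep : ℕ → Blk n m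
  tStep : ℕ → Blk n m
  ν : ℕ → ℝ
  σ : ℕ → ℝ
  B : ℕ → Vec n →L[ℝ] Vec n
  N : ℕ → Vec n →L[ℝ] Blk n m

namespace Seqs

variable (S : Seqs n m) (f : Vec n → ℝ) (g : Vec n → Vec m)

/-- The local data at iteration `k`. -/
def loc (k : ℕ) : Local n m where
  gradf := gradient f (S.x k)
  gval := g (S.x k)
  A := conGrad g (S.x k)
  y := S.y k
  B := S.B k
  σ := S.σ k

/-- The trial step `d_k = n_k + t_k`. -/
def step (k : ℕ) : Blk n m := S.nStep k + S.tStep k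

/-- Actual reduction of the merit function. -/
def ared (μ : ℝ) (k : ℕ) : ℝ :=
  merit f g μ (S.ν k) (S.x k) (S.y k)
    - merit f g μ (S.ν k) (S.x k + (S.step k).fst) (S.y k + (S.step k).snd)

/-- The descent ratio `ρ_k`. -/
def rho (μ : ℝ) (k : ℕ) : ℝ := S.ared f g μ k / (S.loc f g k).pred μ (S.ν k) (S.step k)

/-- `ν̃_k`. -/
def nuTilde (P : Params) (μ : ℝ) (k : ℕ) : ℝ :=
  (S.loc f g k).nuTilde μ P.ξ P.δ (S.nStep k) (S.tStep k)

/-- `S` is an infinite sequence generated by the inner loop of ARCBIP on the barrier problem with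
parameter `μ`, started with penalty parameter `νinit`. -/
structure IsRun (P : Params) (μ νinit : ℝ) : Prop where
  νinit_pos : 0 < νinit
  y_zero_pos : ∀ i, 0 < S.y 0 i
  σ_pos : ∀ k, 0 < S.σ k
  B_symm : ∀ k, IsSelfAdjoint (S.B k)
  N_inj : ∀ k, Function.Injective (S.N k)
  N_range : ∀ k, LinearMap.range (S.N k).toLinearMap = LinearMap.ker (jac (conGrad g (S.x k)))
  normal_feasible : ∀ k, S.nStep k ∈ (S.loc f g k).normalFeasible P.ξ P.τ
  range_space : ∀ k, (S.loc f g k).RangeSpaceCondition P.ξ P.τ (S.nStep k)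
  normal_cauchy : ∀ k, (S.loc f g k).NormalCauchyDecrease P.ξ P.τ P.γn (S.nStep k)
  tang_feasible : ∀ k, S.tStep k ∈ (S.loc f g k).tangFeasible P.τ (S.nStep k)
  tang_cauchy : ∀ k,
    (S.loc f g k).TangCauchyDecrease μ P.τ P.γt (S.N k) (S.nStep k) (S.tStep k)
  ν_zero : S.ν 0 = penaltyUpdate νinit (S.nuTilde f g P μ 0)
  ν_succ : ∀ k, S.ν (k + 1) = penaltyUpdate (S.ν k) (S.nuTilde f g P μ (k + 1))
  accept : ∀ k, P.η₁ ≤ S.rho f g μ k →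
    S.x (k + 1) = S.x k + (S.step k).fst ∧ S.y (k + 1) = S.y k + (S.step k).snd
  reject : ∀ k, S.rho f g μ k < P.η₁ → S.x (k + 1) = S.x k ∧ S.y (k + 1) = S.y k
  σ_very_successful : ∀ k, P.η₂ ≤ S.rho f g μ k → S.σ (k + 1) ≤ S.σ k
  σ_successful : ∀ k, P.η₁ ≤ S.rho f g μ k → S.rho f g μ k < P.η₂ →
    S.σ k ≤ S.σ (k + 1) ∧ S.σ (k + 1) ≤ P.γ₁ * S.σ k
  σ_unsuccessful : ∀ k, S.rho f g μ k < P.η₁ →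
    P.γ₁ * S.σ k ≤ S.σ (k + 1) ∧ S.σ (k + 1) ≤ P.γ₂ * S.σ k

/-- `f` and `g` are differentiable on an open convex set containing all the iterates, and `∇f`, `g`
and `A` are Lipschitz continuous there. -/
def A1 : Prop :=
  ∃ X : Set (Vec n), IsOpen X ∧ Convex ℝ X ∧ (∀ k, S.x k ∈ X) ∧
    DifferentiableOn ℝ f X ∧ DifferentiableOn ℝ g X ∧
    (∃ K, LipschitzOnWith K (gradient f) X) ∧ (∃ K, LipschitzOnWith K g X) ∧
    (∃ K, LipschitzOnWith K (conGrad g) X)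

/-- `f_k` is bounded below and `∇f_k`, `g_k`, `A_k`, `B_k` are bounded. -/
def A2 : Prop :=
  (∃ C, ∀ k, C ≤ f (S.x k)) ∧ (∃ C, ∀ k, ‖gradient f (S.x k)‖ ≤ C) ∧
    (∃ C, ∀ k, ‖g (S.x k)‖ ≤ C) ∧ (∃ C, ∀ k, ‖conGrad g (S.x k)‖ ≤ C) ∧
    (∃ C, ∀ k, ‖S.B k‖ ≤ C)

/-- The `n` singular values of the `(n + m) × n` matrix `N_k` are bounded below,
and its norm is bounded above. -/
def A3 : Prop :=
  ∃ γN : ℝ, 0 < γN ∧ ∀ k, ‖S.N k‖ ≤ γN ∧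
    ∀ i < n, γN⁻¹ ≤ (S.N k).toLinearMap.singularValues i

/-- The `m` singular values of the `m × (n + m)` matrices `(A_kᵀ Y_k)` are bounded away from
zero. -/
def JacobianBoundedAway : Prop :=
  ∃ γ : ℝ, 0 < γ ∧ ∀ k, ∀ i < m,
    γ ≤ (scaledJac (conGrad g (S.x k)) (S.y k)).singularValues i

end Seqs

end ARCBIP

end

/-!
Write `D` for the scaling `d ↦ (d_x; Y⁻¹ d_y)`, `c` for the constraint residual `g + y` and
`s = σ ^ (-1/2)`. All predicted reductions are measured against `min 1 s`.

*Potential.* Dividing the merit function, shifted by a lower bound of the barrier function, by the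
penalty parameter gives a nonnegative quantity that never increases, even where the penalty
parameter grows (`exists_potential`). It bounds `c`, hence `y`, and an accepted step decreases it by
a fraction of the predicted reduction divided by `1 + ν`.

*One convergence principle, used twice.* Nonnegative predicted reductions force `‖D d‖ = O(s)` for
`σ ≥ 1`. Suppose that the predicted reduction is at least a multiple of `(1 + ν) * min 1 s` wherever
a measure `θ` is bounded away from zero. If `θ` stayed away from zero, the steps would be dominated
by the decreases of the potential, so the `x_k` would converge; near the limit `f` and `g` are
uniformly differentiable, so steps with small `s` are very successful, `s` stays bounded below, and
infinitely many steps decrease the potential by a fixed amount. Hence `liminf θ = 0`, and since `θ`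
is Lipschitz along the iterates, every excursion of `θ` away from zero costs a fixed decrease
(`tendsto_zero_of_sufficient_decrease`, `tendsto_zero_of_le_pred`). Only differentiability at a limit
point of the iterates is used for trial points, so these need not lie in the set on which the
Lipschitz conditions hold.

*Feasibility.* With `θ = ‖c‖`, sufficient predicted reduction comes from the normal step:
`npred ≥ κ min(‖c‖, s)`.

*Penalty parameter.* Once `c` is small, the unconstrained minimiser of the normal subproblem, which
lies in the range space, is feasible, so the range space condition applies. Then `‖D n‖` is at most
of the order of `‖c‖`, and `D n` is orthogonal to `D t`, so that
`‖D d‖ ^ 3 - ‖D t‖ ^ 3 = O(‖D n‖ ^ 2 (‖D t‖ + ‖D n‖))`. This bounds the penalty threshold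
(`exists_nuTilde_le`), the penalty parameter is eventually constant, and the barrier term keeps the
slacks away from zero.

*Dual residual.* With `θ` the norm of the dual residual, which `p_k^c` controls because `N_x` is
invertible with bounded inverse (`norm_dualResidual_le`), the tangential step provides the reduction
(`exists_mul_min_le_tpred`), and what the normal step spoils is bounded by a multiple of the
predicted reduction itself (`exists_mul_tpred_le_pred`).
-/

namespace ARCBIP

open Filter Topology

/-! ### Singular values -/

section SingularValues

variable {E F : Type*} [NormedAddCommGroup E] [InnerProductSpace ℝ E] [FiniteDimensional ℝ E]
  [NormedAddCommGroup F] [InnerProductSpace ℝ F] [FiniteDimensional ℝ F]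

/-- If the first `r` singular values of `T` are at least `γ`, then `T` expands the span of the
corresponding `r` right singular vectors by at least the factor `γ`. -/
theorem exists_finrank_eq_le_norm_of_le_singularValues (T : E →ₗ[ℝ] F) {r : ℕ} {γ : ℝ}
    (hγ : 0 ≤ γ) (hr : r ≤ Module.finrank ℝ E) (h : ∀ i < r, γ ≤ T.singularValues i) :
    ∃ W : Submodule ℝ E, Module.finrank ℝ W = r ∧ ∀ w ∈ W, γ * ‖w‖ ≤ ‖T w‖ := by
  classical
  set hT := T.isSymmetric_adjoint_comp_self
  set b := hT.eigenvectorBasis rfl with hb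
  set u : Fin r → E := fun i => b (Fin.castLE hr i) with hu
  have hinj : Function.Injective (Fin.castLE hr) := Fin.castLE_injective hr
  have huo : Orthonormal ℝ u := b.orthonormal.comp _ hinj
  refine ⟨Submodule.span ℝ (Set.range u), ?_, ?_⟩
  · rw [finrank_span_eq_card huo.linearIndependent, Fintype.card_fin]
  · intro w hw
    obtain ⟨a, rfl⟩ := (Submodule.mem_span_range_iff_exists_fun ℝ).1 hw
    have hTu : ∀ i j, ⟪T (u i), T (u j)⟫_ℝ = if i = j then T.singularValues i ^ 2 else 0 := by
      intro i j
      rw [← LinearMap.adjoint_inner_left]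
      have : T.adjoint (T (u i)) = (T.singularValues i ^ 2) • u i := by
        have := hT.apply_eigenvectorBasis rfl (Fin.castLE hr i)
        rw [← T.sq_singularValues_fin] at this
        exact this
      rw [this, inner_smul_left, orthonormal_iff_ite.1 huo]
      simp
    have h1 : ‖T (∑ i, a i • u i)‖ ^ 2 = ∑ i, a i ^ 2 * T.singularValues i ^ 2 := by
      rw [← real_inner_self_eq_norm_sq, map_sum, sum_inner]
      refine Finset.sum_congr rfl fun i _ => ?_
      rw [inner_sum]
      simp only [map_smul, inner_smul_left, inner_smul_right, hTu]
      simp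
      ring
    have h2 : ‖∑ i, a i • u i‖ ^ 2 = ∑ i, a i ^ 2 := by
      rw [← real_inner_self_eq_norm_sq, huo.inner_sum]
      simp [sq]
    refine abs_le_of_sq_le_sq' ?_ (norm_nonneg _) |>.2
    rw [mul_pow, h1, h2, Finset.mul_sum]
    refine Finset.sum_le_sum fun i _ => ?_
    rw [mul_comm]
    exact mul_le_mul_of_nonneg_left (pow_le_pow_left₀ hγ (h i i.2) 2) (sq_nonneg _)

/-- If all the singular values of a map onto an `r`-dimensional space are at least `γ`, its adjoint
is bounded below by `γ`. -/
theorem le_norm_adjoint_of_le_singularValues (T : E →ₗ[ℝ] F) {γ : ℝ}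
    (hγ : 0 < γ) (hr : Module.finrank ℝ F ≤ Module.finrank ℝ E)
    (h : ∀ i < Module.finrank ℝ F, γ ≤ T.singularValues i) (v : F) :
    γ * ‖v‖ ≤ ‖T.adjoint v‖ := by
  obtain ⟨W, hW, hT⟩ := exists_finrank_eq_le_norm_of_le_singularValues T hγ.le hr h
  have hinj : Function.Injective (T ∘ₗ W.subtype) := by
    rw [injective_iff_map_eq_zero]
    intro w hw
    have := hT w w.2
    have hw' : T w = 0 := hw
    rw [hw', norm_zero] at this
    have h0 : ‖(w : E)‖ = 0 := by nlinarith [norm_nonneg (w : E)]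
    simpa using h0
  obtain ⟨w, hw⟩ := (LinearMap.injective_iff_surjective_of_finrank_eq_finrank hW).1 hinj v
  have hw' : T w = v := hw
  have h1 := hT w w.2
  rw [hw'] at h1
  have h2 : ‖v‖ ^ 2 ≤ ‖(w : E)‖ * ‖T.adjoint v‖ := by
    rw [← real_inner_self_eq_norm_sq]
    nth_rewrite 1 [← hw']
    rw [← LinearMap.adjoint_inner_right]
    exact real_inner_le_norm _ _
  rcases (norm_nonneg v).eq_or_lt with h0 | h0
  · rw [← h0, mul_zero]; exact norm_nonneg _
  · have h3 := mul_le_mul_of_nonneg_right h1 (norm_nonneg (T.adjoint v))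
    nlinarith [h0, h2, h3]

/-- If all the singular values of `T` are at least `γ`, then `T` is bounded below by `γ`. -/
theorem le_norm_of_le_singularValues (T : E →ₗ[ℝ] F) {γ : ℝ}
    (hγ : 0 ≤ γ) (h : ∀ i < Module.finrank ℝ E, γ ≤ T.singularValues i) (v : E) :
    γ * ‖v‖ ≤ ‖T v‖ := by
  obtain ⟨W, hW, hT⟩ := exists_finrank_eq_le_norm_of_le_singularValues T hγ le_rfl h
  exact hT v (Submodule.eq_top_of_finrank_eq hW ▸ Submodule.mem_top)

end SingularValues

/-! ### An abstract convergence principle for descent methods -/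

section Sequences

variable {E : Type*} [NormedAddCommGroup E] [CompleteSpace E]

/-- Convergence to zero of a stationarity measure `θ` for a descent method with step scale `s`,
for which `acc k` and `vs k` say that step `k` is accepted, resp. very successful. Whenever `θ` is
bounded away from zero, an accepted step decreases `Ψ ≥ 0` in proportion to `min 1 s`, which bounds
the displacement of `x` and the change of `θ`. The scale `s` shrinks only at steps that are not very
successful, and small steps near a limit of `x` are very successful if `θ` is bounded away from
zero. -/
theorem tendsto_zero_of_sufficient_decrease (x : ℕ → E) (Ψ θ s : ℕ → ℝ) (acc vs : ℕ → Prop)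
    {c₁ c₂ C : ℝ} {K₀ : ℕ} (hc₁ : 0 ≤ c₁) (hc₁' : c₁ < 1) (hc₂ : 0 < c₂) (hC : 0 < C)
    (hΨ0 : ∀ k, 0 ≤ Ψ k) (hΨ : Antitone Ψ) (hθ : ∀ k, 0 ≤ θ k) (hs : ∀ k, 0 < s k)
    (hvs_s : ∀ k, vs k → s k ≤ s (k + 1))
    (hnvs_s : ∀ k, ¬ vs k → c₂ * s k ≤ s (k + 1))
    (hnacc_s : ∀ k, ¬ acc k → s (k + 1) ≤ c₁ * s k)
    (hnacc_x : ∀ k, ¬ acc k → x (k + 1) = x k) (hnacc_θ : ∀ k, ¬ acc k → θ (k + 1) = θ k)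
    (hstep_x : ∀ k ≥ K₀, acc k → s k ≤ 1 → ‖x (k + 1) - x k‖ ≤ C * s k)
    (hstep_θ : ∀ k ≥ K₀, acc k → s k ≤ 1 → |θ (k + 1) - θ k| ≤ C * s k)
    (hdec : ∀ ε > 0, ∃ κ > 0, ∃ K, ∀ k ≥ K, acc k → ε ≤ θ k →
      κ * min 1 (s k) ≤ Ψ k - Ψ (k + 1))
    (hvs : ∀ x₀, Tendsto x atTop (𝓝 x₀) → ∀ ε > 0, ∃ r > 0, ∃ K, ∀ k ≥ K, ε ≤ θ k → s k ≤ r →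
      vs k) :
    Tendsto θ atTop (𝓝 0) := by
  obtain ⟨l, hl⟩ : ∃ l, Tendsto Ψ atTop (𝓝 l) :=
    ⟨_, tendsto_atTop_ciInf hΨ ⟨0, by rintro _ ⟨k, rfl⟩; exact hΨ0 k⟩⟩
  have hdiff : Tendsto (fun k => Ψ k - Ψ (k + 1)) atTop (𝓝 0) := by
    simpa using hl.sub (hl.comp (tendsto_add_atTop_nat 1))
  -- once the decreases are small, they dominate the changes of `x` and `θ`
  have key : ∀ ε > 0, ∃ Q > 0, ∃ K, ∀ k ≥ K, ε ≤ θ k →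
      ‖x (k + 1) - x k‖ ≤ Q * (Ψ k - Ψ (k + 1)) ∧
        |θ (k + 1) - θ k| ≤ Q * (Ψ k - Ψ (k + 1)) := by
    intro ε hε
    obtain ⟨κ, hκ, K, hK⟩ := hdec ε hε
    obtain ⟨K', hK'⟩ := eventually_atTop.1 (hdiff.eventually (gt_mem_nhds hκ))
    refine ⟨C / κ, by positivity, max K₀ (max K K'), fun k hk hθk => ?_⟩
    have hk0 : K₀ ≤ k := le_trans (le_max_left _ _) hk
    have hk1 : K ≤ k := le_trans (le_trans (le_max_left _ _) (le_max_right _ _)) hk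
    have hk2 : K' ≤ k := le_trans (le_trans (le_max_right _ _) (le_max_right _ _)) hk
    have hnn : 0 ≤ Ψ k - Ψ (k + 1) := sub_nonneg.2 (hΨ (Nat.le_succ k))
    by_cases ha : acc k
    · have h1 := hK k hk1 ha hθk
      have h2 := hK' k hk2
      have h3 : s k ≤ 1 := by
        by_contra hcon
        rw [min_eq_left (not_le.1 hcon).le] at h1
        linarith
      rw [min_eq_right h3] at h1
      have h4 : C * s k ≤ C / κ * (Ψ k - Ψ (k + 1)) := by
        rw [div_mul_eq_mul_div, le_div_iff₀ hκ]
        nlinarith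
      exact ⟨(hstep_x k hk0 ha h3).trans h4, (hstep_θ k hk0 ha h3).trans h4⟩
    · rw [hnacc_x k ha, hnacc_θ k ha]
      simp only [sub_self, norm_zero, abs_zero]
      exact ⟨by positivity, by positivity⟩
  have claim : ∀ ε > 0, ∀ K, ∃ k ≥ K, θ k < ε := by
    intro ε hε K₁
    by_contra! hcon
    obtain ⟨Q, hQ, K₂, hK₂⟩ := key ε hε
    obtain ⟨κ, hκ, K₃, hK₃⟩ := hdec ε hε
    have hsum : Summable fun k => dist (x k) (x (k + 1)) := by
      rw [← summable_nat_add_iff (max K₁ K₂)]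
      refine summable_of_sum_range_le (c := Q * Ψ (max K₁ K₂)) (fun _ => dist_nonneg) fun N => ?_
      have h1 : ∀ N, ∑ i ∈ Finset.range N,
          dist (x (i + max K₁ K₂)) (x (i + max K₁ K₂ + 1)) ≤
          Q * (Ψ (max K₁ K₂) - Ψ (N + max K₁ K₂)) := by
        intro N
        induction N with
        | zero => simp
        | succ N ih =>
          rw [Finset.sum_range_succ]
          have h2 := (hK₂ (N + max K₁ K₂) (by omega) (hcon _ (by omega))).1
          rw [dist_comm, dist_eq_norm]
          have h3 : N + 1 + max K₁ K₂ = N + max K₁ K₂ + 1 := by omega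
          rw [h3]
          linarith
      refine (h1 N).trans ?_
      have := hΨ0 (N + max K₁ K₂)
      exact mul_le_mul_of_nonneg_left (by linarith) hQ.le
    obtain ⟨x₀, hx₀⟩ := cauchySeq_tendsto_of_complete (cauchySeq_of_summable_dist hsum)
    obtain ⟨r, hr, K₄, hK₄⟩ := hvs x₀ hx₀ ε hε
    set K₅ := max K₁ K₄ with hK₅
    -- the step scale stays above `b`
    set b := min (s K₅) (c₂ * r) with hb
    have hb0 : 0 < b := lt_min (hs _) (by positivity)
    have hsb : ∀ j, b ≤ s (K₅ + j) := by
      intro j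
      induction j with
      | zero => exact min_le_left _ _
      | succ j ih =>
        by_cases hv : vs (K₅ + j)
        · exact ih.trans (hvs_s _ hv)
        · have h1 : r < s (K₅ + j) := by
            by_contra hcon'
            exact hv (hK₄ _ (by omega) (hcon _ (by omega)) (not_lt.1 hcon'))
          calc b ≤ c₂ * r := min_le_right _ _
            _ ≤ c₂ * s (K₅ + j) := by gcongr
            _ ≤ _ := hnvs_s _ hv
    have hpos : 0 < κ * min 1 b := mul_pos hκ (lt_min one_pos hb0)
    obtain ⟨K₆, hK₆⟩ := eventually_atTop.1 (hdiff.eventually (gt_mem_nhds hpos))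
    have hna : ∀ k ≥ max K₃ (max K₅ K₆), ¬ acc k := by
      intro k hk ha
      have h1 := hK₃ k (by omega) ha (hcon _ (by omega))
      have h2 := hK₆ k (by omega)
      have h3 : b ≤ s k := by
        have := hsb (k - K₅)
        rwa [Nat.add_sub_cancel' (by omega)] at this
      have h4 : κ * min 1 b ≤ κ * min 1 (s k) := by gcongr
      linarith
    set K₇ := max K₃ (max K₅ K₆) with hK₇
    have hgeom : ∀ j, s (K₇ + j) ≤ c₁ ^ j * s K₇ := by
      intro j
      induction j with
      | zero => simp
      | succ j ih =>
        calc s (K₇ + j + 1) ≤ c₁ * s (K₇ + j) := hnacc_s _ (hna _ (by omega))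
          _ ≤ c₁ * (c₁ ^ j * s K₇) := by gcongr
          _ = _ := by ring
    have hlim : Tendsto (fun j => c₁ ^ j * s K₇) atTop (𝓝 0) := by
      simpa using (tendsto_pow_atTop_nhds_zero_of_lt_one hc₁ hc₁').mul_const (s K₇)
    obtain ⟨j, hj⟩ := (hlim.eventually (gt_mem_nhds hb0)).exists
    have h1 := hsb (K₇ - K₅ + j)
    have h2 : K₅ + (K₇ - K₅ + j) = K₇ + j := by omega
    rw [h2] at h1
    linarith [hgeom j]
  -- excursions of `θ` above `2 ε` cost a fixed amount of decrease
  rw [Metric.tendsto_atTop]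
  by_contra! hcon
  obtain ⟨ε', hε', hfreq⟩ := hcon
  obtain ⟨ε, hε, rfl⟩ : ∃ ε > 0, ε' = 2 * ε := ⟨ε' / 2, by positivity, by ring⟩
  obtain ⟨Q, hQ, K, hK⟩ := key ε hε
  obtain ⟨K', hK'⟩ := eventually_atTop.1
    (hl.eventually (gt_mem_nhds (show l < l + ε / Q by have := div_pos hε hQ; linarith)))
  obtain ⟨k, hk, hθk⟩ := hfreq (max K K')
  rw [dist_zero_right, Real.norm_of_nonneg (hθ k)] at hθk
  have hge : ∀ j, l ≤ Ψ j := fun j => hΨ.le_of_tendsto hl j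
  have hQε : Q * (ε / Q) = ε := by field_simp
  have hind : ∀ j, 2 * ε - Q * (Ψ k - Ψ (k + j)) ≤ θ (k + j) ∧ ε ≤ θ (k + j) := by
    have hlow : ∀ j, 2 * ε - Q * (Ψ k - Ψ (k + j)) ≤ θ (k + j) → ε ≤ θ (k + j) := by
      intro j hj
      have h1 := hK' k (le_trans (le_max_right _ _) hk)
      have h2 := hge (k + j)
      have : Q * (Ψ k - Ψ (k + j)) ≤ Q * (ε / Q) := by gcongr; linarith
      linarith
    intro j
    induction j with
    | zero => exact ⟨by simpa using hθk, hlow 0 (by simpa using hθk)⟩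
    | succ j ih =>
      have h1 := (hK (k + j) (by omega) ih.2).2
      have h2 := (abs_le.1 h1).1
      have h3 : 2 * ε - Q * (Ψ k - Ψ (k + (j + 1))) ≤ θ (k + (j + 1)) := by
        rw [← add_assoc]
        linarith [ih.1]
      exact ⟨h3, hlow _ h3⟩
  obtain ⟨i, hi, hlt⟩ := claim ε hε k
  have := (hind (i - k)).2
  rw [Nat.add_sub_cancel' hi] at this
  linarith

end Sequences

variable {n m : ℕ}

/-! ### Block vectors, the scaling and the range space -/

@[simp] theorem blk_fst (a : Vec n) (b : Vec m) : (blk a b).fst = a := rfl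

@[simp] theorem blk_snd (a : Vec n) (b : Vec m) : (blk a b).snd = b := rfl

theorem norm_sq_blk (d : Blk n m) : ‖d‖ ^ 2 = ‖d.fst‖ ^ 2 + ‖d.snd‖ ^ 2 :=
  WithLp.prod_norm_sq_eq_of_L2 d

theorem norm_fst_le (d : Blk n m) : ‖d.fst‖ ≤ ‖d‖ :=
  abs_le_of_sq_le_sq' (by rw [norm_sq_blk]; nlinarith [sq_nonneg ‖d.snd‖]) (norm_nonneg _) |>.2

theorem norm_snd_le (d : Blk n m) : ‖d.snd‖ ≤ ‖d‖ :=
  abs_le_of_sq_le_sq' (by rw [norm_sq_blk]; nlinarith [sq_nonneg ‖d.fst‖]) (norm_nonneg _) |>.2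

theorem norm_le_fst_add_snd (d : Blk n m) : ‖d‖ ≤ ‖d.fst‖ + ‖d.snd‖ := by
  have h1 := norm_nonneg d.fst
  have h2 := norm_nonneg d.snd
  exact abs_le_of_sq_le_sq' (by rw [norm_sq_blk]; nlinarith) (by positivity) |>.2

theorem jac_apply (A : Vec m →L[ℝ] Vec n) (d : Blk n m) :
    jac A d = ContinuousLinearMap.adjoint A d.fst + d.snd := rfl

theorem abs_apply_le_norm (v : Vec m) (i : Fin m) : |v i| ≤ ‖v‖ := by
  simpa using PiLp.norm_apply_le v i

theorem norm_le_card_mul (v : Vec m) {b : ℝ} (h : ∀ i, |v i| ≤ b) : ‖v‖ ≤ m * b := by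
  rcases Nat.eq_zero_or_pos m with rfl | hm
  · simp [EuclideanSpace.norm_eq]
  · have hb : 0 ≤ b := (abs_nonneg _).trans (h ⟨0, hm⟩)
    have hm1 : (1 : ℝ) ≤ m := by exact_mod_cast hm
    refine abs_le_of_sq_le_sq' ?_ (by positivity) |>.2
    rw [EuclideanSpace.real_norm_sq_eq]
    calc ∑ i, v i ^ 2 ≤ ∑ _i : Fin m, b ^ 2 :=
          Finset.sum_le_sum fun i _ => sq_le_sq' (abs_le.1 (h i)).1 (abs_le.1 (h i)).2
      _ = m * b ^ 2 := by simp
      _ ≤ (m * b) ^ 2 := by nlinarith [sq_nonneg b, mul_nonneg (sq_nonneg b) (by linarith : (0:ℝ) ≤ m)]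

theorem norm_mul_le (y v : Vec m) : ‖(WithLp.toLp 2 fun i => y i * v i : Vec m)‖ ≤ ‖y‖ * ‖v‖ := by
  refine abs_le_of_sq_le_sq' ?_ (by positivity) |>.2
  rw [mul_pow, EuclideanSpace.real_norm_sq_eq, EuclideanSpace.real_norm_sq_eq v, Finset.mul_sum]
  refine Finset.sum_le_sum fun i _ => ?_
  show (y i * v i) ^ 2 ≤ _
  rw [mul_pow]
  refine mul_le_mul_of_nonneg_right ?_ (sq_nonneg _)
  have := abs_apply_le_norm y i
  exact sq_le_sq' (abs_le.1 this).1 (abs_le.1 this).2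

namespace Local

variable (L : Local n m)

theorem scale_add (d t : Blk n m) : L.scale (d + t) = L.scale d + L.scale t := by
  unfold scale blk
  rw [← WithLp.toLp_add]
  congr 1
  ext i
  · simp
  · simp [add_div]

theorem scale_smul (a : ℝ) (d : Blk n m) : L.scale (a • d) = a • L.scale d := by
  unfold scale blk
  rw [← WithLp.toLp_smul]
  congr 1
  ext i
  · simp
  · simp [mul_div_assoc]

@[simp] theorem scale_zero : L.scale 0 = 0 := by
  simpa using L.scale_smul 0 0

@[simp] theorem scale_snd (d : Blk n m) (i : Fin m) : (L.scale d).snd i = d.snd i / L.y i := rfl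

theorem norm_scale_smul (a : ℝ) (d : Blk n m) : ‖L.scale (a • d)‖ = |a| * ‖L.scale d‖ := by
  rw [scale_smul, norm_smul, Real.norm_eq_abs]

theorem norm_fst_le_scale (d : Blk n m) : ‖d.fst‖ ≤ ‖L.scale d‖ := norm_fst_le (L.scale d)

theorem abs_div_le_scale (d : Blk n m) (i : Fin m) : |d.snd i / L.y i| ≤ ‖L.scale d‖ :=
  (abs_apply_le_norm (L.scale d).snd i).trans (norm_snd_le _)

theorem snd_eq_mul (hy : ∀ i, 0 < L.y i) (d : Blk n m) :
    d.snd = WithLp.toLp 2 fun i => L.y i * (L.scale d).snd i := by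
  ext i
  simp [mul_div_cancel₀ _ (hy i).ne']

theorem norm_snd_le_scale (hy : ∀ i, 0 < L.y i) (d : Blk n m) :
    ‖d.snd‖ ≤ ‖L.y‖ * ‖L.scale d‖ := by
  rw [L.snd_eq_mul hy d]
  refine (norm_mul_le _ _).trans ?_
  exact mul_le_mul_of_nonneg_left (norm_snd_le (L.scale d)) (norm_nonneg _)

theorem eq_zero_of_norm_scale (hy : ∀ i, 0 < L.y i) {d : Blk n m} (h : ‖L.scale d‖ = 0) :
    d = 0 := by
  have h1 : d.fst = 0 := norm_eq_zero.1 (le_antisymm (h ▸ L.norm_fst_le_scale d) (norm_nonneg _))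
  have h2 : d.snd = 0 := by
    have := L.norm_snd_le_scale hy d
    rw [h, mul_zero] at this
    exact norm_eq_zero.1 (le_antisymm this (norm_nonneg _))
  have : d = blk d.fst d.snd := rfl
  rw [this, h1, h2]
  rfl

/-- `ω ↦ (A; Y²) ω`, a parametrisation of the range space. -/
def rangeVec : Vec m →ₗ[ℝ] Blk n m where
  toFun ω := blk (L.A ω) (WithLp.toLp 2 fun i => L.y i ^ 2 * ω i)
  map_add' a b := by
    unfold blk
    rw [← WithLp.toLp_add]
    congr 1
    ext i
    · simp
    · simp [mul_add]
  map_smul' a b := by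
    unfold blk
    rw [RingHom.id_apply, ← WithLp.toLp_smul]
    congr 1
    ext i
    · simp
    · simp
      ring

/-- `ω ↦ (A; Y) ω`, the adjoint of `(Aᵀ Y)`. -/
def scaledAdj (ω : Vec m) : Blk n m := blk (L.A ω) (WithLp.toLp 2 fun i => L.y i * ω i)

theorem scale_rangeVec (hy : ∀ i, 0 < L.y i) (ω : Vec m) :
    L.scale (L.rangeVec ω) = L.scaledAdj ω := by
  unfold scale scaledAdj
  congr 1
  ext i
  have : L.y i ≠ 0 := (hy i).ne'
  simp [rangeVec]
  field_simp

theorem inner_scaledAdj_scale (hy : ∀ i, 0 < L.y i) (ω : Vec m) (d : Blk n m) :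
    ⟪L.scaledAdj ω, L.scale d⟫_ℝ = ⟪ω, jac L.A d⟫_ℝ := by
  rw [WithLp.prod_inner_apply, jac_apply, inner_add_right,
    ContinuousLinearMap.adjoint_inner_right]
  congr 1
  simp only [PiLp.inner_apply]
  refine Finset.sum_congr rfl fun i _ => ?_
  have : L.y i ≠ 0 := (hy i).ne'
  simp [scaledAdj, scale, blk]
  field_simp

theorem adjoint_scaledJac (ω : Vec m) :
    LinearMap.adjoint (scaledJac L.A L.y) ω = L.scaledAdj ω := by
  refine ext_inner_right ℝ fun d => ?_
  rw [LinearMap.adjoint_inner_left, WithLp.prod_inner_apply]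
  have : scaledJac L.A L.y d = ContinuousLinearMap.adjoint L.A d.fst + slackDiag L.y d.snd := rfl
  rw [this, inner_add_right, ContinuousLinearMap.adjoint_inner_right]
  congr 1
  simp only [PiLp.inner_apply]
  refine Finset.sum_congr rfl fun i _ => ?_
  simp [scaledAdj, blk, slackDiag, Matrix.toLpLin_apply, Matrix.mulVec_diagonal]
  ring

theorem norm_scaledAdj_le (ω : Vec m) : ‖L.scaledAdj ω‖ ≤ (‖L.A‖ + ‖L.y‖) * ‖ω‖ := by
  refine (norm_le_fst_add_snd _).trans ?_
  rw [add_mul]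
  exact add_le_add (L.A.le_opNorm ω) (norm_mul_le _ _)

theorem norm_jac_le (hy : ∀ i, 0 < L.y i) (d : Blk n m) :
    ‖jac L.A d‖ ≤ (‖L.A‖ + ‖L.y‖) * ‖L.scale d‖ := by
  rw [jac_apply, add_mul]
  refine (norm_add_le _ _).trans (add_le_add ?_ (L.norm_snd_le_scale hy d))
  refine (ContinuousLinearMap.le_opNorm _ _).trans ?_
  rw [LinearIsometryEquiv.norm_map]
  exact mul_le_mul_of_nonneg_left (L.norm_fst_le_scale d) (norm_nonneg _)

theorem normalDir_eq : L.normalDir = -L.rangeVec L.res := by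
  unfold normalDir rangeVec blk
  rfl

theorem norm_scale_rangeVec_sq (hy : ∀ i, 0 < L.y i) (ω : Vec m) :
    ‖L.scale (L.rangeVec ω)‖ ^ 2 = ⟪ω, jac L.A (L.rangeVec ω)⟫_ℝ := by
  rw [← L.inner_scaledAdj_scale hy, L.scale_rangeVec hy, real_inner_self_eq_norm_sq]

section RangeSpace

variable {γ : ℝ}

/-- On the range space, the linearised constraint controls the scaled step. -/
theorem mul_norm_scale_rangeVec_le (hy : ∀ i, 0 < L.y i)
    (hJ : ∀ v, γ * ‖v‖ ≤ ‖L.scaledAdj v‖) (hγ : 0 < γ) (ω : Vec m) :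
    γ * ‖L.scale (L.rangeVec ω)‖ ≤ ‖jac L.A (L.rangeVec ω)‖ := by
  have h1 := L.norm_scale_rangeVec_sq hy ω
  have h2 := hJ ω
  rw [← L.scale_rangeVec hy] at h2
  have h3 := real_inner_le_norm ω (jac L.A (L.rangeVec ω))
  rcases (norm_nonneg (L.scale (L.rangeVec ω))).eq_or_lt with h0 | h0
  · rw [← h0, mul_zero]; exact norm_nonneg _
  · have h4 := mul_le_mul_of_nonneg_right h2 (norm_nonneg (jac L.A (L.rangeVec ω)))
    nlinarith

/-- Every step is dominated by the range space step with the same linearised constraint value. -/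
theorem exists_rangeVec_le (hy : ∀ i, 0 < L.y i)
    (hJ : ∀ v, γ * ‖v‖ ≤ ‖L.scaledAdj v‖) (hγ : 0 < γ) (d : Blk n m) :
    ∃ ω, jac L.A (L.rangeVec ω) = jac L.A d ∧ ‖L.scale (L.rangeVec ω)‖ ≤ ‖L.scale d‖ := by
  have hinj : Function.Injective (jac L.A ∘ₗ L.rangeVec) := by
    rw [injective_iff_map_eq_zero]
    intro ω hω
    have h0 : jac L.A (L.rangeVec ω) = 0 := hω
    have h1 := L.norm_scale_rangeVec_sq hy ω
    rw [h0, inner_zero_right] at h1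
    have h2 := hJ ω
    rw [← L.scale_rangeVec hy, pow_eq_zero_iff two_ne_zero |>.1 h1] at h2
    have : ‖ω‖ = 0 := by nlinarith [norm_nonneg ω]
    simpa using this
  obtain ⟨ω, hω⟩ := (LinearMap.injective_iff_surjective.1 hinj) (jac L.A d)
  have hω' : jac L.A (L.rangeVec ω) = jac L.A d := hω
  refine ⟨ω, hω', ?_⟩
  have h1 := L.norm_scale_rangeVec_sq hy ω
  rw [hω', ← L.inner_scaledAdj_scale hy, ← L.scale_rangeVec hy] at h1
  have h2 := real_inner_le_norm (L.scale (L.rangeVec ω)) (L.scale d)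
  by_contra! hcon
  nlinarith [norm_nonneg (L.scale d)]

theorem continuous_scaledAdj : Continuous L.scaledAdj := by
  unfold scaledAdj blk
  refine (WithLp.prod_continuous_toLp 2 _ _).comp (Continuous.prodMk L.A.continuous ?_)
  refine (PiLp.continuous_toLp 2 _).comp (continuous_pi fun i => ?_)
  fun_prop

/-- The normal subproblem without its bounds has a solution in the range space. -/
theorem exists_rangeVec_isMin (hy : ∀ i, 0 < L.y i)
    (hJ : ∀ v, γ * ‖v‖ ≤ ‖L.scaledAdj v‖) (hγ : 0 < γ) {ξ : ℝ} (hσ : 0 < L.sigmaTilde ξ) :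
    ∃ ω, ∀ d, L.normalObj ξ (L.rangeVec ω) ≤ L.normalObj ξ d := by
  have hcont : Continuous fun ω => L.normalObj ξ (L.rangeVec ω) := by
    have h1 : Continuous fun ω => jac L.A (L.rangeVec ω) :=
      LinearMap.continuous_of_finiteDimensional (jac L.A ∘ₗ L.rangeVec)
    unfold normalObj
    simp only [L.scale_rangeVec hy]
    have := L.continuous_scaledAdj
    fun_prop
  have hlim : Filter.Tendsto (fun ω => L.normalObj ξ (L.rangeVec ω)) (Filter.cocompact _)
      Filter.atTop := by
    have h1 : Filter.Tendsto (fun ω : Vec m => 1 / 3 * L.sigmaTilde ξ * γ ^ 3 * ‖ω‖ ^ 3)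
        (Filter.cocompact _) Filter.atTop :=
      ((Filter.tendsto_pow_atTop three_ne_zero).comp tendsto_norm_cocompact_atTop).const_mul_atTop
        (by positivity)
    refine Filter.tendsto_atTop_mono (fun ω => ?_) h1
    unfold normalObj
    have h2 := pow_le_pow_left₀ (by positivity) (hJ ω) 3
    rw [L.scale_rangeVec hy, mul_assoc _ (γ ^ 3), ← mul_pow]
    have : 1 / 3 * L.sigmaTilde ξ * (γ * ‖ω‖) ^ 3 ≤
      1 / 3 * L.sigmaTilde ξ * ‖L.scaledAdj ω‖ ^ 3 := by gcongr
    nlinarith [sq_nonneg ‖L.res + jac L.A (L.rangeVec ω)‖]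
  obtain ⟨ω, hω⟩ := hcont.exists_forall_le hlim
  refine ⟨ω, fun d => ?_⟩
  obtain ⟨ω', h1, h2⟩ := L.exists_rangeVec_le hy hJ hγ d
  refine (hω ω').trans ?_
  unfold normalObj
  rw [h1]
  gcongr

theorem mul_norm_scale_le_of_norm_le (hy : ∀ i, 0 < L.y i)
    (hJ : ∀ v, γ * ‖v‖ ≤ ‖L.scaledAdj v‖) (hγ : 0 < γ) {d : Blk n m} (hd : d ∈ L.rangeSpace)
    (h : ‖L.res + jac L.A d‖ ≤ ‖L.res‖) : γ * ‖L.scale d‖ ≤ 2 * ‖L.res‖ := by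
  obtain ⟨ω, rfl⟩ := hd
  refine (L.mul_norm_scale_rangeVec_le hy hJ hγ ω).trans ?_
  have h1 : jac L.A (L.rangeVec ω) = (L.res + jac L.A (L.rangeVec ω)) - L.res := by abel
  rw [h1]
  refine (norm_sub_le _ _).trans ?_
  have : ‖L.res + jac L.A (L.rangeVec ω)‖ ≤ ‖L.res‖ := h
  linarith

/-- Close to feasibility the solution of the unbounded normal subproblem respects the bounds, so
that the range space condition applies. -/
theorem mem_rangeSpace_of_norm_res_lt (hy : ∀ i, 0 < L.y i)
    (hJ : ∀ v, γ * ‖v‖ ≤ ‖L.scaledAdj v‖) (hγ : 0 < γ) {ξ τ : ℝ} (hσ : 0 < L.sigmaTilde ξ)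
    {d : Blk n m} (hd : L.RangeSpaceCondition ξ τ d) (hres : 2 * ‖L.res‖ ≤ γ * (ξ * τ)) :
    d ∈ L.rangeSpace := by
  obtain ⟨ω, hω⟩ := L.exists_rangeVec_isMin hy hJ hγ hσ
  have hmem : L.rangeVec ω ∈ L.rangeSpace := ⟨ω, rfl⟩
  refine hd ⟨L.rangeVec ω, ?_, fun d _ => hω d, hmem⟩
  have h0 := hω 0
  have h1 : ‖L.res + jac L.A (L.rangeVec ω)‖ ≤ ‖L.res‖ := by
    refine abs_le_of_sq_le_sq' ?_ (norm_nonneg _) |>.2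
    unfold normalObj at h0
    have : 0 ≤ 1 / 3 * L.sigmaTilde ξ * ‖L.scale (L.rangeVec ω)‖ ^ 3 := by positivity
    simp only [map_zero, add_zero, scale_zero, norm_zero] at h0
    norm_num at h0
    nlinarith
  have h2 := L.mul_norm_scale_le_of_norm_le hy hJ hγ hmem h1
  have h3 : ‖L.scale (L.rangeVec ω)‖ ≤ ξ * τ := le_of_mul_le_mul_left (h2.trans hres) hγ
  intro i
  have h4 := (abs_le.1 ((L.abs_div_le_scale (L.rangeVec ω) i).trans h3)).1
  rw [le_div_iff₀ (hy i)] at h4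
  linarith

/-- Range space steps are orthogonal, in the scaled inner product, to steps in the null space of the
constraint Jacobian. -/
theorem inner_scale_eq_zero (hy : ∀ i, 0 < L.y i) {d t : Blk n m} (hd : d ∈ L.rangeSpace)
    (ht : jac L.A t = 0) : ⟪L.scale d, L.scale t⟫_ℝ = 0 := by
  obtain ⟨ω, rfl⟩ := hd
  have : L.scale (L.rangeVec ω) = L.scaledAdj ω := L.scale_rangeVec hy ω
  change ⟪L.scale (L.rangeVec ω), L.scale t⟫_ℝ = 0
  rw [this, L.inner_scaledAdj_scale hy, ht, inner_zero_right]

end RangeSpace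

end Local

/-! ### Predicted reductions and the normal step -/

theorem pos_of_mul_sq_eq_one {σ s : ℝ} (h : σ * s ^ 2 = 1) : 0 < σ :=
  pos_of_mul_pos_left (h ▸ one_pos) (sq_nonneg s)

namespace Local

variable (L : Local n m)

/-- All the data at the iteration are bounded by `K ≥ 1`. -/
structure BoundedBy (K : ℝ) : Prop where
  one_le : 1 ≤ K
  gradf : ‖L.gradf‖ ≤ K
  res : ‖L.res‖ ≤ K
  A : ‖L.A‖ ≤ K
  y : ‖L.y‖ ≤ K
  B : ‖L.B‖ ≤ K

theorem abs_sum_div_le (d : Blk n m) : |∑ i, d.snd i / L.y i| ≤ m * ‖L.scale d‖ := by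
  calc |∑ i, d.snd i / L.y i| ≤ ∑ i, |d.snd i / L.y i| := Finset.abs_sum_le_sum_abs _ _
    _ ≤ ∑ _i : Fin m, ‖L.scale d‖ := Finset.sum_le_sum fun i _ => L.abs_div_le_scale d i
    _ = _ := by simp

theorem abs_sum_mul_div_sq_le (d t : Blk n m) :
    |∑ i, d.snd i * t.snd i / L.y i ^ 2| ≤ m * (‖L.scale d‖ * ‖L.scale t‖) := by
  calc |∑ i, d.snd i * t.snd i / L.y i ^ 2| ≤ ∑ i, |d.snd i * t.snd i / L.y i ^ 2| :=
        Finset.abs_sum_le_sum_abs _ _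
    _ ≤ ∑ _i : Fin m, ‖L.scale d‖ * ‖L.scale t‖ := by
        refine Finset.sum_le_sum fun i _ => ?_
        have : d.snd i * t.snd i / L.y i ^ 2 = (d.snd i / L.y i) * (t.snd i / L.y i) := by
          rw [sq, mul_div_mul_comm]
        rw [this, abs_mul]
        exact mul_le_mul (L.abs_div_le_scale d i) (L.abs_div_le_scale t i) (abs_nonneg _)
          (norm_nonneg _)
    _ = _ := by simp

theorem sum_sq_div_sq_le (d : Blk n m) :
    ∑ i, d.snd i ^ 2 / L.y i ^ 2 ≤ ‖L.scale d‖ ^ 2 := by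
  have h1 : ∑ i, d.snd i ^ 2 / L.y i ^ 2 = ‖(L.scale d).snd‖ ^ 2 := by
    rw [EuclideanSpace.real_norm_sq_eq]
    exact Finset.sum_congr rfl fun i _ => by rw [scale_snd, div_pow]
  rw [h1]
  exact pow_le_pow_left₀ (norm_nonneg _) (norm_snd_le _) 2

theorem sum_sq_div_sq_nonneg (d : Blk n m) : 0 ≤ ∑ i, d.snd i ^ 2 / L.y i ^ 2 :=
  Finset.sum_nonneg fun i _ => by positivity

theorem npred_zero (ξ : ℝ) : L.npred ξ 0 = 0 := by simp [npred]

theorem tpred_zero (μ : ℝ) (d : Blk n m) : L.tpred μ d 0 = 0 := by simp [tpred]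

theorem npred_nonneg {ξ τ γn : ℝ} (hy : ∀ i, 0 < L.y i) (hξτ : 0 ≤ ξ * τ) (hγn : 0 < γn)
    {d : Blk n m} (h : L.NormalCauchyDecrease ξ τ γn d) : 0 ≤ L.npred ξ d := by
  obtain ⟨α, hα, hmax, hle⟩ := h
  have h0 : (0 : ℝ) ∈ L.normalLengths ξ τ := by
    refine ⟨le_rfl, fun i => ?_⟩
    have := mul_nonneg hξτ (hy i).le
    simpa using this
  have h1 := hmax h0
  simp only [Set.mem_ofPred_eq, zero_smul, npred_zero] at h1
  exact (mul_nonneg hγn.le h1).trans hle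

theorem tpred_nonneg {μ τ γt : ℝ} {N : Vec n →L[ℝ] Blk n m} (hγt : 0 < γt)
    {d t : Blk n m} (hd : ∀ i, -(τ * L.y i) ≤ d.snd i) (h : L.TangCauchyDecrease μ τ γt N d t) :
    0 ≤ L.tpred μ d t := by
  obtain ⟨β, hβ, hmin, hle⟩ := h
  have h0 : (0 : ℝ) ∈ L.tangLengths μ τ N d := by
    refine ⟨le_rfl, fun i => ?_⟩
    simpa using hd i
  have h1 := hmin h0
  simp only [Set.mem_ofPred_eq, zero_smul, tpred_zero] at h1
  exact (mul_nonneg hγt.le (by linarith)).trans hle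

/-- Decomposition of the predicted reduction of the merit function along `d + t`. -/
theorem pred_add (hB : IsSelfAdjoint L.B) (μ ν ξ : ℝ) {d t : Blk n m} (ht : jac L.A t = 0) :
    L.pred μ ν (d + t) = L.tpred μ d t +
      1 / 3 * L.σ * (‖L.scale t‖ ^ 3 - ‖L.scale (d + t)‖ ^ 3) + L.chi μ d +
      ν * (L.npred ξ d + 1 / 3 * L.sigmaTilde ξ * ‖L.scale d‖ ^ 3) := by
  have hsym : ⟪d.fst, L.B t.fst⟫_ℝ = ⟪L.B d.fst, t.fst⟫_ℝ := by
    rw [← ContinuousLinearMap.adjoint_inner_left, hB.adjoint_eq]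
  have hsym' : ⟪t.fst, L.B d.fst⟫_ℝ = ⟪L.B d.fst, t.fst⟫_ℝ := real_inner_comm _ _
  have hs1 : ∑ i, (d + t).snd i / L.y i = ∑ i, d.snd i / L.y i + ∑ i, t.snd i / L.y i := by
    rw [← Finset.sum_add_distrib]
    exact Finset.sum_congr rfl fun i _ => by simp [add_div]
  have hs2 : ∑ i, (d + t).snd i ^ 2 / L.y i ^ 2 = ∑ i, d.snd i ^ 2 / L.y i ^ 2 +
      2 * ∑ i, d.snd i * t.snd i / L.y i ^ 2 + ∑ i, t.snd i ^ 2 / L.y i ^ 2 := by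
    rw [Finset.mul_sum, ← Finset.sum_add_distrib, ← Finset.sum_add_distrib]
    refine Finset.sum_congr rfl fun i _ => ?_
    simp only [WithLp.add_snd, PiLp.add_apply]
    ring
  have hfst : (d + t).fst = d.fst + t.fst := rfl
  unfold pred model
  rw [hs1, hs2, hfst, map_add (jac L.A), ht]
  simp only [map_add, inner_add_left, inner_add_right, hsym, hsym', add_zero, map_zero, scale_zero,
    norm_zero]
  unfold tpred chi npred
  simp only [inner_add_left]
  simp
  ring

theorem neg_le_mul_of_neg_div_le {R E ν : ℝ} (hE : 0 ≤ E) (h0 : E = 0 → 0 ≤ R)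
    (h : -(R / E) ≤ ν) : -R ≤ ν * E := by
  rcases hE.eq_or_lt with hE | hE
  · rw [← hE, mul_zero]
    linarith [h0 hE.symm]
  · rwa [← neg_div, div_le_iff₀ hE] at h

theorem sigmaTilde_pos {ξ : ℝ} (hξ : 0 < ξ) (hσ : 0 < L.σ) : 0 < L.sigmaTilde ξ := by
  unfold sigmaTilde
  positivity

theorem sigma_le_sigmaTilde {ξ : ℝ} (hξ : 0 < ξ) (hξ1 : ξ < 1) (hσ : 0 < L.σ) :
    L.σ ≤ L.sigmaTilde ξ := by
  unfold sigmaTilde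
  rw [le_div_iff₀ (by positivity)]
  have : ξ ^ 3 ≤ 1 := pow_le_one₀ hξ.le hξ1.le
  nlinarith

/-- What the two entries of the penalty threshold are chosen for: lower bounds of the predicted
reduction in terms of the normal, resp. the tangential predicted reduction. -/
theorem le_pred_of_nuTilde_le (hy : ∀ i, 0 < L.y i) (hσ : 0 < L.σ) (hB : IsSelfAdjoint L.B)
    {μ ν ξ δ : ℝ} (hξ : 0 < ξ) (hδ1 : δ < 1) {d t : Blk n m}
    (ht : jac L.A t = 0) (hn : 0 ≤ L.npred ξ d) (htp : 0 ≤ L.tpred μ d t)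
    (hν : L.nuTilde μ ξ δ d t ≤ ν) :
    ν * (δ * L.npred ξ d) ≤ L.pred μ ν (d + t) ∧
      L.tpred μ d t + L.chi μ d + ν * (1 / 2 * L.npred ξ d) ≤ L.pred μ ν (d + t) := by
  have hst := L.sigmaTilde_pos hξ hσ
  have hcub : 0 ≤ 1 / 3 * L.sigmaTilde ξ * ‖L.scale d‖ ^ 3 := by positivity
  have hzero : 1 / 3 * L.sigmaTilde ξ * ‖L.scale d‖ ^ 3 = 0 → d = 0 := by
    intro h
    refine L.eq_zero_of_norm_scale hy ?_
    have : 1 / 3 * L.sigmaTilde ξ ≠ 0 := by positivity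
    exact pow_eq_zero_iff three_ne_zero |>.1 ((mul_eq_zero.1 h).resolve_left this)
  obtain ⟨hν1, hν2⟩ := max_le_iff.1 hν
  rw [L.pred_add hB μ ν ξ ht]
  have hnδ : 0 ≤ (1 - δ) * L.npred ξ d := mul_nonneg (by linarith) hn
  have h1 := neg_le_mul_of_neg_div_le (by positivity) (fun h => by
    have hd := hzero (by linarith)
    subst hd
    simpa [chi] using htp) hν1
  have h2 := neg_le_mul_of_neg_div_le (by positivity) (fun h => by
    have hd := hzero (by linarith)
    subst hd
    simp) hν2
  constructor <;> nlinarith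

theorem norm_scale_normalDir (hy : ∀ i, 0 < L.y i) :
    ‖L.scale L.normalDir‖ = ‖L.scaledAdj L.res‖ := by
  rw [normalDir_eq, ← neg_one_smul ℝ, norm_scale_smul, L.scale_rangeVec hy]
  simp

theorem norm_scaledAdj_le_of_boundedBy {K : ℝ} (hL : L.BoundedBy K) (v : Vec m) :
    ‖L.scaledAdj v‖ ≤ 2 * K * ‖v‖ :=
  (L.norm_scaledAdj_le _).trans
    (mul_le_mul_of_nonneg_right (by linarith [hL.A, hL.y]) (norm_nonneg _))

theorem norm_jac_le_of_boundedBy (hy : ∀ i, 0 < L.y i) {K : ℝ} (hL : L.BoundedBy K) (d : Blk n m) :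
    ‖jac L.A d‖ ≤ 2 * K * ‖L.scale d‖ :=
  (L.norm_jac_le hy d).trans
    (mul_le_mul_of_nonneg_right (by linarith [hL.A, hL.y]) (norm_nonneg _))

/-- The scaled normal step is at most of the order of `s = σ ^ (-1/2)`. -/
theorem norm_scale_normal_le (hy : ∀ i, 0 < L.y i) (hσ : 0 < L.σ) {K ξ s : ℝ}
    (hL : L.BoundedBy K) (hξ : 0 < ξ) (hξ1 : ξ < 1) (hs : 0 < s) (hσs : L.σ * s ^ 2 = 1)
    {d : Blk n m} (hn : 0 ≤ L.npred ξ d) : ‖L.scale d‖ ≤ 6 * K * s := by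
  have hK := hL.one_le
  rcases (norm_nonneg (L.scale d)).eq_or_lt with h0 | h0
  · rw [← h0]; positivity
  have h1 := L.norm_jac_le_of_boundedBy hy hL d
  have h2 : ‖L.res‖ - ‖L.res + jac L.A d‖ ≤ ‖jac L.A d‖ := by
    have := norm_sub_le (L.res + jac L.A d) (jac L.A d)
    rw [add_sub_cancel_right] at this
    linarith
  unfold npred at hn
  have h3 : 1 / 3 * L.σ * ‖L.scale d‖ ^ 3 ≤ 1 / 3 * L.sigmaTilde ξ * ‖L.scale d‖ ^ 3 := by
    gcongr
    exact L.sigma_le_sigmaTilde hξ hξ1 hσ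
  have h4 : L.σ * ‖L.scale d‖ ^ 2 ≤ 6 * K := by
    refine le_of_mul_le_mul_right ?_ h0
    nlinarith
  have h5 : ‖L.scale d‖ ^ 2 ≤ 6 * K * s ^ 2 := by
    calc ‖L.scale d‖ ^ 2 = (L.σ * ‖L.scale d‖ ^ 2) * s ^ 2 := by
          rw [mul_right_comm, hσs, one_mul]
      _ ≤ _ := by gcongr
  refine abs_le_of_sq_le_sq' (h5.trans ?_) (by positivity) |>.2
  rw [mul_pow]
  gcongr
  nlinarith

theorem norm_res_add_jac_le {ξ : ℝ} (hξ : 0 < ξ) (hσ : 0 < L.σ) {d : Blk n m}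
    (hn : 0 ≤ L.npred ξ d) : ‖L.res + jac L.A d‖ ≤ ‖L.res‖ := by
  have := L.sigmaTilde_pos hξ hσ
  have : 0 ≤ 1 / 3 * L.sigmaTilde ξ * ‖L.scale d‖ ^ 3 := by positivity
  unfold npred at hn
  linarith

theorem norm_scale_le_two_div_mul {γ ξ : ℝ} (hy : ∀ i, 0 < L.y i)
    (hJ : ∀ v, γ * ‖v‖ ≤ ‖L.scaledAdj v‖) (hγ : 0 < γ) (hξ : 0 < ξ) (hσ : 0 < L.σ)
    {d : Blk n m} (hd : d ∈ L.rangeSpace) (hn : 0 ≤ L.npred ξ d) :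
    ‖L.scale d‖ ≤ 2 / γ * ‖L.res‖ := by
  have h1 := L.mul_norm_scale_le_of_norm_le hy hJ hγ hd (L.norm_res_add_jac_le hξ hσ hn)
  rw [div_mul_eq_mul_div, le_div_iff₀ hγ]
  linarith

/-- A normal step in the range space with sufficient normal decrease is paid for by that
decrease. -/
theorem mul_norm_scale_le_npred {K γ ξ κ s : ℝ} (hy : ∀ i, 0 < L.y i) (hL : L.BoundedBy K)
    (hJ : ∀ v, γ * ‖v‖ ≤ ‖L.scaledAdj v‖) (hγ : 0 < γ) (hξ : 0 < ξ) (hξ1 : ξ < 1) (hκ : 0 < κ)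
    (hs : 0 < s) (hσs : L.σ * s ^ 2 = 1) {d : Blk n m} (hd : d ∈ L.rangeSpace)
    (hn : κ * min ‖L.res‖ s ≤ L.npred ξ d) :
    κ * ‖L.scale d‖ ≤ (2 / γ + 6 * K) * L.npred ξ d := by
  have hK := hL.one_le
  have hσ := pos_of_mul_sq_eq_one hσs
  have hn0 : 0 ≤ L.npred ξ d := le_trans (mul_nonneg hκ.le (le_min (norm_nonneg _) hs.le)) hn
  have hNs := L.norm_scale_normal_le hy hσ hL hξ hξ1 hs hσs hn0
  have hNa := L.norm_scale_le_two_div_mul hy hJ hγ hξ hσ hd hn0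
  have h1 : ‖L.scale d‖ ≤ (2 / γ + 6 * K) * min ‖L.res‖ s := by
    rw [mul_min_of_nonneg _ _ (by positivity)]
    have e1 : 0 ≤ 6 * K * ‖L.res‖ := by positivity
    have e2 : 0 ≤ 2 / γ * s := by positivity
    exact le_min (by rw [add_mul]; linarith) (by rw [add_mul]; linarith)
  calc κ * ‖L.scale d‖ ≤ κ * ((2 / γ + 6 * K) * min ‖L.res‖ s) := by gcongr
    _ = (2 / γ + 6 * K) * (κ * min ‖L.res‖ s) := by ring
    _ ≤ _ := by gcongr

/-- Decrease of the linearised constraint violation along the scaled steepest descent direction. -/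
theorem le_norm_res_sub_norm {K γ α : ℝ} (hy : ∀ i, 0 < L.y i) (hL : L.BoundedBy K) (hγ : 0 < γ)
    (hJ : ∀ v, γ * ‖v‖ ≤ ‖L.scaledAdj v‖) (hα : 0 ≤ α) (hαK : α * (4 * K ^ 2) ≤ 1) :
    α * γ ^ 2 * ‖L.res‖ / 2 ≤ ‖L.res‖ - ‖L.res + jac L.A (α • L.normalDir)‖ := by
  have hK := hL.one_le
  set a := ‖L.res‖ with ha_def
  set h := ‖L.scaledAdj L.res‖ with hh
  have hh1 : γ * a ≤ h := hJ _
  have hh2 : h ≤ 2 * K * a := L.norm_scaledAdj_le_of_boundedBy hL _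
  have ha : 0 ≤ a := norm_nonneg _
  have hh0 : 0 ≤ h := norm_nonneg _
  set w := jac L.A (L.rangeVec L.res) with hw
  have hjac : jac L.A (α • L.normalDir) = -(α • w) := by
    rw [map_smul, normalDir_eq, map_neg, smul_neg]
  have hinner : ⟪L.res, w⟫_ℝ = h ^ 2 := by
    rw [hw, ← L.norm_scale_rangeVec_sq hy, L.scale_rangeVec hy]
  have hwn : ‖w‖ ≤ 2 * K * h := by
    have := L.norm_jac_le_of_boundedBy hy hL (L.rangeVec L.res)
    rwa [L.scale_rangeVec hy] at this
  rw [hjac, ← sub_eq_add_neg]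
  have hsq : ‖L.res - α • w‖ ^ 2 ≤ a ^ 2 - α * h ^ 2 := by
    rw [norm_sub_sq_real, inner_smul_right, hinner, norm_smul, Real.norm_of_nonneg hα]
    have h1 : ‖w‖ ^ 2 ≤ 4 * K ^ 2 * h ^ 2 :=
      (pow_le_pow_left₀ (norm_nonneg _) hwn 2).trans_eq (by ring)
    have h2 : (α * ‖w‖) ^ 2 ≤ α * h ^ 2 := by
      calc (α * ‖w‖) ^ 2 = α ^ 2 * ‖w‖ ^ 2 := by ring
        _ ≤ α ^ 2 * (4 * K ^ 2 * h ^ 2) := by gcongr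
        _ = (α * h ^ 2) * (α * (4 * K ^ 2)) := by ring
        _ ≤ (α * h ^ 2) * 1 := by gcongr
        _ = _ := mul_one _
    linarith
  have hγh : γ ^ 2 * a ^ 2 ≤ h ^ 2 :=
    (mul_pow γ a 2).symm.trans_le (pow_le_pow_left₀ (by positivity) hh1 2)
  have hsq2 : ‖L.res - α • w‖ ^ 2 ≤ (a - α * γ ^ 2 * a / 2) ^ 2 := by
    have h1 := mul_le_mul_of_nonneg_left hγh hα
    have h2 := sq_nonneg (α * γ ^ 2 * a / 2)
    have h3 : (a - α * γ ^ 2 * a / 2) ^ 2 =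
      a ^ 2 - α * (γ ^ 2 * a ^ 2) + (α * γ ^ 2 * a / 2) ^ 2 := by ring
    linarith
  have hnn : 0 ≤ a - α * γ ^ 2 * a / 2 := by
    rcases ha.eq_or_lt with h0 | h0
    · simp [← h0]
    have h1 : γ ≤ 2 * K := le_of_mul_le_mul_right (hh1.trans hh2) h0
    have h2 : γ ^ 2 ≤ 4 * K ^ 2 := (pow_le_pow_left₀ hγ.le h1 2).trans_eq (by ring)
    have h3 : α * γ ^ 2 ≤ 1 := (mul_le_mul_of_nonneg_left h2 hα).trans hαK
    have h4 := mul_le_mul_of_nonneg_right h3 ha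
    linarith
  have := abs_le_of_sq_le_sq' hsq2 hnn |>.2
  linarith

theorem cubic_normalDir_le {K γ ξ α b s : ℝ} (hy : ∀ i, 0 < L.y i) (hσ : 0 < L.σ)
    (hL : L.BoundedBy K) (hξ : 0 < ξ) (hb : b ^ 2 * (16 * K ^ 3) ≤ γ ^ 2 * ξ ^ 3) (hα : 0 ≤ α)
    (hσs : L.σ * s ^ 2 = 1) (hαa : α * ‖L.res‖ ≤ b * s) :
    1 / 3 * L.sigmaTilde ξ * ‖L.scale (α • L.normalDir)‖ ^ 3 ≤ α * γ ^ 2 * ‖L.res‖ / 4 := by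
  have hK := hL.one_le
  have ha : 0 ≤ ‖L.res‖ := norm_nonneg _
  rw [norm_scale_smul, L.norm_scale_normalDir hy, abs_of_nonneg hα]
  set a := ‖L.res‖ with ha_def
  set h := ‖L.scaledAdj L.res‖ with hh
  have hh0 : 0 ≤ h := norm_nonneg _
  have hh2 : h ≤ 2 * K * a := L.norm_scaledAdj_le_of_boundedBy hL _
  have h1 : h ^ 3 ≤ 8 * K ^ 3 * a ^ 3 := (pow_le_pow_left₀ hh0 hh2 3).trans_eq (by ring)
  have h2 : (α * a) ^ 2 ≤ b ^ 2 * s ^ 2 :=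
    (pow_le_pow_left₀ (by positivity) hαa 2).trans_eq (by ring)
  have h3 : L.σ * (α * h) ^ 3 ≤ 8 * K ^ 3 * b ^ 2 * (α * a) := by
    calc L.σ * (α * h) ^ 3 = L.σ * α ^ 3 * h ^ 3 := by ring
      _ ≤ L.σ * α ^ 3 * (8 * K ^ 3 * a ^ 3) := mul_le_mul_of_nonneg_left h1 (by positivity)
      _ = 8 * K ^ 3 * L.σ * (α * a) * (α * a) ^ 2 := by ring
      _ ≤ 8 * K ^ 3 * L.σ * (α * a) * (b ^ 2 * s ^ 2) :=
          mul_le_mul_of_nonneg_left h2 (by positivity)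
      _ = 8 * K ^ 3 * b ^ 2 * (α * a) * (L.σ * s ^ 2) := by ring
      _ = _ := by rw [hσs, mul_one]
  unfold sigmaTilde
  have h4 : 1 / 3 * (L.σ / ξ ^ 3) * (α * h) ^ 3 = L.σ * (α * h) ^ 3 / (3 * ξ ^ 3) := by
    field_simp
  rw [h4, div_le_iff₀ (by positivity)]
  have h5 := mul_le_mul_of_nonneg_right hb (by positivity : 0 ≤ α * a)
  have h6 : 0 ≤ γ ^ 2 * ξ ^ 3 * (α * a) := by positivity
  calc L.σ * (α * h) ^ 3 ≤ 8 * K ^ 3 * b ^ 2 * (α * a) := h3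
    _ = b ^ 2 * (16 * K ^ 3) * (α * a) / 2 := by ring
    _ ≤ γ ^ 2 * ξ ^ 3 * (α * a) * (3 / 4) := by linarith
    _ = _ := by ring

/-- Sufficient normal decrease. -/
theorem exists_mul_min_le_npred (n m : ℕ) {K γ ξ τ γn : ℝ} (hK : 1 ≤ K) (hγ : 0 < γ) (hξ : 0 < ξ)
    (hξ1 : ξ < 1) (hτ : 0 < τ) (hτ1 : τ < 1) (hγn : 0 < γn) :
    ∃ κ > 0, ∀ (L : Local n m) (s : ℝ) (d : Blk n m), (∀ i, 0 < L.y i) → L.BoundedBy K →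
      (∀ v, γ * ‖v‖ ≤ ‖L.scaledAdj v‖) → 0 < s → L.σ * s ^ 2 = 1 →
      L.NormalCauchyDecrease ξ τ γn d → κ * min ‖L.res‖ s ≤ L.npred ξ d := by
  set α₀ := ξ * τ / (4 * K ^ 2) with hα₀
  set b := min 1 (γ ^ 2 * ξ ^ 3 / (16 * K ^ 3)) with hb
  have hα₀pos : 0 < α₀ := by positivity
  have hbpos : 0 < b := lt_min one_pos (by positivity)
  have hξτ : ξ * τ ≤ 1 := by nlinarith
  have hα₀K : α₀ * (4 * K ^ 2) = ξ * τ := by rw [hα₀]; field_simp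
  have hbK : b ^ 2 * (16 * K ^ 3) ≤ γ ^ 2 * ξ ^ 3 := by
    have h1 : b ^ 2 ≤ b := by
      have : b ≤ 1 := min_le_left _ _
      nlinarith
    have h2 : b * (16 * K ^ 3) ≤ γ ^ 2 * ξ ^ 3 := by
      rw [← le_div_iff₀ (by positivity)]
      exact min_le_right _ _
    nlinarith [pow_pos (lt_of_lt_of_le one_pos hK) 3]
  refine ⟨γn * (γ ^ 2 / 4 * min α₀ b), by have := lt_min hα₀pos hbpos; positivity, ?_⟩
  intro L s d hy hL hJ hs hσs hcauchy
  rcases (norm_nonneg L.res).eq_or_lt with h0 | ha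
  · rw [← h0, min_eq_left hs.le, mul_zero]
    exact L.npred_nonneg hy (by positivity) hγn hcauchy
  set a := ‖L.res‖ with ha_def
  set α := min α₀ (b * s / a) with hα
  have hαpos : 0 < α := lt_min hα₀pos (by positivity)
  have hα1 : α ≤ α₀ := min_le_left _ _
  have hα2 : α * a ≤ b * s := by
    rw [← le_div_iff₀ ha]
    exact min_le_right _ _
  have hmem : α ∈ L.normalLengths ξ τ := by
    refine ⟨hαpos.le, fun i => ?_⟩
    have h1 : (α • L.normalDir).snd i = -(α * (L.y i * L.res i) * L.y i) := by
      simp [normalDir, blk]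
      ring
    rw [h1]
    have hyi : L.y i ≤ K := (le_abs_self _).trans ((abs_apply_le_norm _ _).trans hL.y)
    have hci : L.res i ≤ K := (le_abs_self _).trans ((abs_apply_le_norm _ _).trans hL.res)
    have h2 : L.y i * L.res i ≤ K * K := by
      have := (hy i).le
      nlinarith
    have h3 : α * (L.y i * L.res i) ≤ ξ * τ := by
      calc α * (L.y i * L.res i) ≤ α * (K * K) := by gcongr
        _ ≤ α₀ * (4 * K ^ 2) := mul_le_mul hα1 (by nlinarith) (by positivity) hα₀pos.le
        _ = _ := hα₀K
    have := mul_le_mul_of_nonneg_right h3 (hy i).le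
    linarith
  have hαK : α * (4 * K ^ 2) ≤ 1 := by
    calc α * (4 * K ^ 2) ≤ α₀ * (4 * K ^ 2) := by gcongr
      _ ≤ 1 := by rw [hα₀K]; exact hξτ
  have hσ0 : 0 < L.σ := pos_of_mul_sq_eq_one hσs
  have hlin := L.le_norm_res_sub_norm hy hL hγ hJ hαpos.le hαK
  have hcub := L.cubic_normalDir_le hy hσ0 hL hξ hbK hαpos.le hσs hα2
  obtain ⟨α', hα', hmax, hle⟩ := hcauchy
  have h1 : L.npred ξ (α • L.normalDir) ≤ L.npred ξ (α' • L.normalDir) := hmax hmem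
  have h2 : α * γ ^ 2 * a / 4 ≤ L.npred ξ (α • L.normalDir) := by
    unfold npred
    linarith
  have h3 : min α₀ b * min a s ≤ α * a := by
    rw [hα, min_mul_of_nonneg _ _ ha.le, div_mul_cancel₀ _ ha.ne']
    have e1 : min α₀ b ≤ α₀ := min_le_left _ _
    have e2 : min α₀ b ≤ b := min_le_right _ _
    have e3 : min a s ≤ a := min_le_left _ _
    have e4 : min a s ≤ s := min_le_right _ _
    have e5 : 0 < min α₀ b := lt_min hα₀pos hbpos
    have e6 : 0 < min a s := lt_min ha hs
    exact le_min (mul_le_mul e1 e3 e6.le hα₀pos.le) (mul_le_mul e2 e4 e6.le hbpos.le)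
  refine le_trans ?_ hle
  rw [mul_assoc]
  refine mul_le_mul_of_nonneg_left ?_ hγn.le
  have := mul_le_mul_of_nonneg_left h3 (by positivity : 0 ≤ γ ^ 2 / 4)
  nlinarith

theorem abs_inner_apply_le {K : ℝ} (hB : ‖L.B‖ ≤ K) (u v : Vec n) :
    |⟪u, L.B v⟫_ℝ| ≤ K * (‖u‖ * ‖v‖) := by
  refine (abs_real_inner_le_norm _ _).trans ?_
  have h1 : ‖L.B v‖ ≤ K * ‖v‖ := (L.B.le_opNorm v).trans (by gcongr)
  calc ‖u‖ * ‖L.B v‖ ≤ ‖u‖ * (K * ‖v‖) := by gcongr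
    _ = _ := by ring

/-- A tangential step with nonnegative predicted reduction has a cubic term dominated by its linear
and quadratic terms. -/
theorem sigma_mul_norm_scale_sq_le {K μ : ℝ} (hL : L.BoundedBy K) (hμ : 0 < μ)
    {d t : Blk n m} (ht : 0 ≤ L.tpred μ d t) :
    L.σ * ‖L.scale t‖ ^ 2 ≤ 3 * (K + μ * m) * (1 + ‖L.scale d‖ + ‖L.scale t‖) := by
  have hK := hL.one_le
  set T := ‖L.scale t‖ with hT
  set N := ‖L.scale d‖ with hN
  have hN0 : 0 ≤ N := norm_nonneg _
  rcases (norm_nonneg (L.scale t)).eq_or_lt with h0 | h0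
  · rw [← hT] at h0
    rw [← h0]
    have : 0 ≤ μ * m := by positivity
    simp
    positivity
  rw [← hT] at h0
  have ht1 : ‖t.fst‖ ≤ T := L.norm_fst_le_scale t
  have hd1 : ‖d.fst‖ ≤ N := L.norm_fst_le_scale d
  have e1 : -⟪L.gradf + L.B d.fst, t.fst⟫_ℝ ≤ (K + K * N) * T := by
    refine (neg_le_abs _).trans ((abs_real_inner_le_norm _ _).trans ?_)
    have h1 : ‖L.gradf + L.B d.fst‖ ≤ K + K * N := by
      refine (norm_add_le _ _).trans (add_le_add hL.gradf ?_)
      refine (L.B.le_opNorm _).trans ?_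
      exact mul_le_mul hL.B hd1 (norm_nonneg _) (by linarith)
    exact mul_le_mul h1 ht1 (norm_nonneg _) (by positivity)
  have e2 : -(1 / 2 * ⟪t.fst, L.B t.fst⟫_ℝ) ≤ 1 / 2 * (K * T ^ 2) := by
    have h1 := (neg_le_abs _).trans (L.abs_inner_apply_le hL.B t.fst t.fst)
    have h2 : K * (‖t.fst‖ * ‖t.fst‖) ≤ K * T ^ 2 := by
      rw [sq]
      gcongr
    linarith
  have e3 := (le_abs_self _).trans (L.abs_sum_div_le t)
  have e4 := (neg_le_abs _).trans (L.abs_sum_mul_div_sq_le d t)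
  have e5 := L.sum_sq_div_sq_nonneg t
  have e6 : μ * (∑ i, t.snd i / L.y i - ∑ i, d.snd i * t.snd i / L.y i ^ 2
        - 1 / 2 * ∑ i, t.snd i ^ 2 / L.y i ^ 2) ≤ μ * (m * T + m * (N * T)) := by
    refine mul_le_mul_of_nonneg_left ?_ hμ.le
    linarith
  unfold tpred at ht
  refine le_of_mul_le_mul_right ?_ h0
  have h7 : 0 ≤ μ * m * T ^ 2 := by positivity
  have h8 : 0 ≤ K * T ^ 2 := by positivity
  rw [← hT] at ht
  nlinarith

end Local

/-! ### The tangential step and the penalty threshold -/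

theorem le_mul_of_sq_le {A B s T : ℝ} (hA : 1 ≤ A) (hB : 0 ≤ B) (hs : 0 < s) (hs1 : s ≤ 1)
    (h : T ^ 2 ≤ A * s ^ 2 * (B + T)) : T ≤ (A * B + A) * s := by
  by_contra! hcon
  have hAB : 0 ≤ A * B := by positivity
  have hT : s < T := by nlinarith
  have h1 : (A * B + A) * s * T < T * T := mul_lt_mul_of_pos_right hcon (hs.trans hT)
  have h2 : A * B * s * s ≤ A * B * s * T := mul_le_mul_of_nonneg_left hT.le (by positivity)
  have h3 : A * s * T * s ≤ A * s * T * 1 := mul_le_mul_of_nonneg_left hs1 (by nlinarith)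
  nlinarith

theorem sq_mul_le_of_eq_one_div {b X : ℝ} (hX : 0 ≤ X) (hb : b = 1 / (2 * (1 + X))) :
    b ^ 2 * X ≤ 1 / 4 := by
  rw [hb, div_pow, div_mul_eq_mul_div, div_le_iff₀ (by positivity)]
  nlinarith

theorem sub_sq_div_le_log {u τ : ℝ} (hτ : τ < 1) (hu : -τ ≤ u) :
    u - u ^ 2 / (1 - τ) ≤ Real.log (1 + u) := by
  have h1 : 0 < 1 + u := by linarith
  refine le_trans ?_ (Real.one_sub_inv_le_log_of_pos h1)
  have h2 : u ^ 2 / (1 + u) ≤ u ^ 2 / (1 - τ) := by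
    apply div_le_div_of_nonneg_left (sq_nonneg u) (by linarith) (by linarith)
  have h3 : 1 - (1 + u)⁻¹ = u - u ^ 2 / (1 + u) := by field_simp; ring
  linarith

namespace Local

variable (L : Local n m)

/-- For large `σ` the scaled tangential step is at most of the order of `s = σ ^ (-1/2)`. -/
theorem norm_scale_tang_le {K μ M s : ℝ} (hL : L.BoundedBy K) (hμ : 0 < μ) (hM : 0 ≤ M)
    (hs : 0 < s) (hs1 : s ≤ 1) (hσs : L.σ * s ^ 2 = 1)
    {d t : Blk n m} (hd : ‖L.scale d‖ ≤ M) (ht : 0 ≤ L.tpred μ d t) :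
    ‖L.scale t‖ ≤ (3 * (K + μ * m) * (1 + M) + 3 * (K + μ * m)) * s := by
  have hK := hL.one_le
  have hμm : 0 ≤ μ * m := by positivity
  have h1 := L.sigma_mul_norm_scale_sq_le hL hμ ht
  refine le_mul_of_sq_le (by linarith) (by linarith) hs hs1 ?_
  calc ‖L.scale t‖ ^ 2 = (L.σ * ‖L.scale t‖ ^ 2) * s ^ 2 := by
        rw [mul_right_comm, hσs, one_mul]
    _ ≤ (3 * (K + μ * m) * (1 + ‖L.scale d‖ + ‖L.scale t‖)) * s ^ 2 := by gcongr
    _ ≤ (3 * (K + μ * m) * (1 + M + ‖L.scale t‖)) * s ^ 2 := by gcongr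
    _ = _ := by ring

theorem exists_sigma_mul_norm_scale_le (n m : ℕ) {K μ M : ℝ} (hK : 1 ≤ K) (hμ : 0 < μ)
    (hM : 0 ≤ M) :
    ∃ Q ≥ 0, ∀ (L : Local n m) (s : ℝ) (d t : Blk n m), L.BoundedBy K → 0 < s →
      L.σ * s ^ 2 = 1 → ‖L.scale d‖ ≤ M → ‖L.scale d‖ ≤ 6 * K * s → 0 ≤ L.tpred μ d t →
      L.σ * ‖L.scale t‖ * ‖L.scale d‖ ^ 2 ≤ Q * ‖L.scale d‖ := by
  set C := 3 * (K + μ * m) with hC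
  have hμm : 0 ≤ μ * m := by positivity
  have hC3 : 3 ≤ C := by linarith
  set Q := C * (1 + M) + C with hQ
  have hQ0 : 1 ≤ Q := by nlinarith
  refine ⟨Q * (6 * K) + Q * M, by positivity, ?_⟩
  intro L s d t hL hs hσs hdM hds ht
  have hN0 := norm_nonneg (L.scale d)
  have hT0 := norm_nonneg (L.scale t)
  have hσ0 : 0 < L.σ := pos_of_mul_sq_eq_one hσs
  rcases le_total s 1 with hs1 | hs1
  · have h1 := L.norm_scale_tang_le hL hμ hM hs hs1 hσs hdM ht
    calc L.σ * ‖L.scale t‖ * ‖L.scale d‖ ^ 2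
        = L.σ * ‖L.scale t‖ * ‖L.scale d‖ * ‖L.scale d‖ := by ring
      _ ≤ L.σ * (Q * s) * ‖L.scale d‖ * (6 * K * s) := by gcongr
      _ = Q * (6 * K) * ‖L.scale d‖ * (L.σ * s ^ 2) := by ring
      _ = Q * (6 * K) * ‖L.scale d‖ := by rw [hσs, mul_one]
      _ ≤ _ := by
        have : 0 ≤ Q * M * ‖L.scale d‖ := by positivity
        linarith
  · have hσ1 : L.σ ≤ 1 := by
      have := mul_le_mul_of_nonneg_left (one_le_pow₀ (n := 2) hs1) hσ0.le
      linarith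
    have h1 := L.sigma_mul_norm_scale_sq_le hL hμ ht
    have h2 : (L.σ * ‖L.scale t‖) ^ 2 ≤ C * 1 ^ 2 * ((1 + M) + L.σ * ‖L.scale t‖) := by
      calc (L.σ * ‖L.scale t‖) ^ 2 = L.σ * (L.σ * ‖L.scale t‖ ^ 2) := by ring
        _ ≤ L.σ * (C * (1 + M + ‖L.scale t‖)) := by
          refine mul_le_mul_of_nonneg_left (h1.trans ?_) hσ0.le
          gcongr
        _ = C * (L.σ * (1 + M) + L.σ * ‖L.scale t‖) := by ring
        _ ≤ C * (1 * (1 + M) + L.σ * ‖L.scale t‖) := by gcongr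
        _ = _ := by ring
    have h3 := le_mul_of_sq_le (by linarith) (by linarith) one_pos le_rfl h2
    calc L.σ * ‖L.scale t‖ * ‖L.scale d‖ ^ 2
        = L.σ * ‖L.scale t‖ * (‖L.scale d‖ * ‖L.scale d‖) := by ring
      _ ≤ (Q * 1) * (M * ‖L.scale d‖) := by gcongr
      _ ≤ _ := by
        have : 0 ≤ Q * (6 * K) * ‖L.scale d‖ := by positivity
        linarith

theorem abs_chi_le {K μ : ℝ} (hL : L.BoundedBy K) (hμ : 0 < μ) (d : Blk n m) :
    |L.chi μ d| ≤ (K + μ * (m + 1)) * (1 + ‖L.scale d‖) * ‖L.scale d‖ := by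
  have hK := hL.one_le
  set N := ‖L.scale d‖ with hN
  have hN0 : 0 ≤ N := norm_nonneg _
  have hd1 : ‖d.fst‖ ≤ N := L.norm_fst_le_scale d
  have e1 : |⟪L.gradf, d.fst⟫_ℝ| ≤ K * N :=
    (abs_real_inner_le_norm _ _).trans (mul_le_mul hL.gradf hd1 (norm_nonneg _) (by linarith))
  have e2 : |⟪d.fst, L.B d.fst⟫_ℝ| ≤ K * N ^ 2 := by
    refine (L.abs_inner_apply_le hL.B d.fst d.fst).trans ?_
    rw [sq]
    gcongr
  have e3 := L.abs_sum_div_le d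
  have e4 := L.sum_sq_div_sq_le d
  have e5 := L.sum_sq_div_sq_nonneg d
  have e6 : |∑ i, d.snd i / L.y i - 1 / 2 * ∑ i, d.snd i ^ 2 / L.y i ^ 2| ≤ m * N + N ^ 2 := by
    rw [abs_le] at e3 ⊢
    constructor <;> nlinarith [e3.1, e3.2]
  have e7 : |μ * (∑ i, d.snd i / L.y i - 1 / 2 * ∑ i, d.snd i ^ 2 / L.y i ^ 2)| ≤
      μ * (m * N + N ^ 2) := by
    rw [abs_mul, abs_of_pos hμ]
    gcongr
  have h1 : |L.chi μ d| ≤ K * N + K * N ^ 2 + μ * (m * N + N ^ 2) := by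
    unfold chi
    have := sq_nonneg N
    have hKN : 0 ≤ K * N ^ 2 := by positivity
    rw [abs_le] at e1 e2 e7 ⊢
    constructor <;> linarith [e1.1, e1.2, e2.1, e2.2, e7.1, e7.2]
  refine h1.trans ?_
  have h2 : 0 ≤ μ * N := by positivity
  have h3 : 0 ≤ μ * m * N ^ 2 := by positivity
  nlinarith

/-- For orthogonal scaled steps, the growth of the cubic term when the normal step is added is
quadratic in the normal step. -/
theorem norm_scale_add_cube_sub_le {d t : Blk n m} (h : ⟪L.scale d, L.scale t⟫_ℝ = 0) :
    ‖L.scale (d + t)‖ ^ 3 - ‖L.scale t‖ ^ 3 ≤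
      ‖L.scale d‖ ^ 2 * (2 * ‖L.scale t‖ + ‖L.scale d‖) := by
  have h1 : ‖L.scale (d + t)‖ ^ 2 = ‖L.scale d‖ ^ 2 + ‖L.scale t‖ ^ 2 := by
    rw [scale_add, norm_add_sq_real, h]
    ring
  have h2 : ‖L.scale (d + t)‖ ≤ ‖L.scale d‖ + ‖L.scale t‖ := by
    rw [scale_add]
    exact norm_add_le _ _
  set D := ‖L.scale (d + t)‖
  set N := ‖L.scale d‖ with hN
  set T := ‖L.scale t‖ with hT
  have hD0 : 0 ≤ D := norm_nonneg _
  have hN0 : 0 ≤ N := norm_nonneg _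
  have hT0 : 0 ≤ T := norm_nonneg _
  have h3 : T * (D - T) ≤ N ^ 2 := by
    have : T ≤ D := abs_le_of_sq_le_sq' (by nlinarith) hD0 |>.2
    nlinarith
  have h4 : D ^ 3 - T ^ 3 = (D ^ 2 - T ^ 2) * D + T * (T * (D - T)) := by ring
  rw [h4, h1]
  have h5 := mul_le_mul_of_nonneg_left h3 hT0
  have h6 := mul_le_mul_of_nonneg_left h2 (sq_nonneg N)
  nlinarith

/-- The penalty threshold is bounded if the normal step satisfies sufficient normal decrease and
lies in the range space. -/
theorem exists_nuTilde_le (n m : ℕ) {K γ μ ξ δ κ : ℝ} (hK : 1 ≤ K) (hγ : 0 < γ) (hμ : 0 < μ)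
    (hξ : 0 < ξ) (hξ1 : ξ < 1) (hδ1 : δ < 1) (hκ : 0 < κ) :
    ∃ Q, ∀ (L : Local n m) (s : ℝ) (d t : Blk n m), (∀ i, 0 < L.y i) → L.BoundedBy K →
      (∀ v, γ * ‖v‖ ≤ ‖L.scaledAdj v‖) → 0 < s → L.σ * s ^ 2 = 1 → d ∈ L.rangeSpace →
      jac L.A t = 0 → 0 ≤ L.tpred μ d t → κ * min ‖L.res‖ s ≤ L.npred ξ d →
      L.nuTilde μ ξ δ d t ≤ Q := by
  set M := 2 * K / γ with hM
  have hM0 : 0 ≤ M := by positivity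
  obtain ⟨Q, hQ0, hQ⟩ := exists_sigma_mul_norm_scale_le n m hK hμ hM0
  set C₅ := 2 / γ + 6 * K with hC₅
  have hC₅0 : 0 < C₅ := by positivity
  set C₆ := (K + μ * (m + 1)) * (1 + M) with hC₆
  have hC₆0 : 0 ≤ C₆ := by positivity
  set G := (Q + C₆) * (C₅ / κ) with hG
  have hG0 : 0 ≤ G := by positivity
  have hδ0 : 0 < 1 - δ := by linarith
  refine ⟨G / (1 - δ) + 2 * G + 1, ?_⟩
  intro L s d t hy hL hJ hs hσs hd ht htp hn
  have hσ0 : 0 < L.σ := pos_of_mul_sq_eq_one hσs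
  have hn0 : 0 ≤ L.npred ξ d := le_trans (mul_nonneg hκ.le (le_min (norm_nonneg _) hs.le)) hn
  have hst := L.sigmaTilde_pos hξ hσ0
  have hss := L.sigma_le_sigmaTilde hξ hξ1 hσ0
  have hcub : 0 ≤ 1 / 3 * L.sigmaTilde ξ * ‖L.scale d‖ ^ 3 := by positivity
  have hN0 : 0 ≤ ‖L.scale d‖ := norm_nonneg _
  have hNs := L.norm_scale_normal_le hy hσ0 hL hξ hξ1 hs hσs hn0
  have hNa := L.norm_scale_le_two_div_mul hy hJ hγ hξ hσ0 hd hn0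
  have hNM : ‖L.scale d‖ ≤ M := by
    refine hNa.trans ?_
    rw [hM, mul_div_right_comm]
    exact mul_le_mul_of_nonneg_left hL.res (by positivity)
  have hNn : ‖L.scale d‖ ≤ C₅ / κ * L.npred ξ d := by
    rw [div_mul_eq_mul_div, le_div_iff₀ hκ, mul_comm]
    exact L.mul_norm_scale_le_npred hy hL hJ hγ hξ hξ1 hκ hs hσs hd hn
  have hΔ : -(1 / 3 * L.σ * (‖L.scale t‖ ^ 3 - ‖L.scale (d + t)‖ ^ 3)) ≤
      Q * ‖L.scale d‖ + 1 / 3 * L.sigmaTilde ξ * ‖L.scale d‖ ^ 3 := by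
    have h1 := L.norm_scale_add_cube_sub_le (L.inner_scale_eq_zero hy hd ht)
    have h2 := mul_le_mul_of_nonneg_left h1 (by positivity : 0 ≤ 1 / 3 * L.σ)
    have h3 := hQ L s d t hL hs hσs hNM hNs htp
    have h4 := mul_le_mul_of_nonneg_right hss (by positivity : 0 ≤ ‖L.scale d‖ ^ 3)
    have h5 : 0 ≤ Q * ‖L.scale d‖ := by positivity
    have h6 : 1 / 3 * L.σ * (‖L.scale d‖ ^ 2 * (2 * ‖L.scale t‖ + ‖L.scale d‖)) =
      2 / 3 * (L.σ * ‖L.scale t‖ * ‖L.scale d‖ ^ 2) + 1 / 3 * (L.σ * ‖L.scale d‖ ^ 3) := by ring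
    rw [h6] at h2
    linarith
  have hχ : -L.chi μ d ≤ C₆ * ‖L.scale d‖ := by
    refine (neg_le_abs _).trans ((L.abs_chi_le hL hμ d).trans ?_)
    rw [hC₆]
    gcongr
  have hG1 : (Q + C₆) * ‖L.scale d‖ ≤ G * L.npred ξ d := by
    calc (Q + C₆) * ‖L.scale d‖ ≤ (Q + C₆) * (C₅ / κ * L.npred ξ d) := by gcongr
      _ = _ := by rw [hG]; ring
  have hC₆N : 0 ≤ C₆ * ‖L.scale d‖ := by positivity
  have hGn : 0 ≤ G * L.npred ξ d := by positivity
  have hGδ : 0 ≤ G / (1 - δ) := by positivity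
  have hnδ : 0 ≤ (1 - δ) * L.npred ξ d := by positivity
  refine max_le ?_ ?_
  · rw [← neg_div]
    refine div_le_of_le_mul₀ (by positivity) (by positivity) ?_
    have h1 : G / (1 - δ) * ((1 - δ) * L.npred ξ d) = G * L.npred ξ d := by
      rw [← mul_assoc, div_mul_cancel₀ _ hδ0.ne']
    have h2 := mul_nonneg hGδ hcub
    have h3 := mul_nonneg hG0 hcub
    have h4 := mul_nonneg hG0 hnδ
    simp only [add_mul, mul_add, one_mul, h1] at hG1 h4 ⊢
    linarith
  · rw [← neg_div]
    refine div_le_of_le_mul₀ (by positivity) (by positivity) ?_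
    have h2 := mul_nonneg hGδ hcub
    have h3 := mul_nonneg hG0 hcub
    have h4 := mul_nonneg hGδ hn0
    have h1 : 2 * G * (1 / 2 * L.npred ξ d) = G * L.npred ξ d := by ring
    simp only [add_mul, mul_add, one_mul, h1] at hG1 ⊢
    linarith

theorem inner_tangDir {μ : ℝ} (N : Vec n →L[ℝ] Blk n m) (d : Blk n m) :
    -⟪L.gradf + L.B d.fst, (N (L.tangDir μ N d)).fst⟫_ℝ +
      μ * (∑ i, (N (L.tangDir μ N d)).snd i / L.y i -
        ∑ i, d.snd i * (N (L.tangDir μ N d)).snd i / L.y i ^ 2) = ‖L.tangDir μ N d‖ ^ 2 := by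
  rw [← real_inner_self_eq_norm_sq]
  nth_rewrite 4 [tangDir]
  rw [ContinuousLinearMap.adjoint_inner_left, WithLp.prod_inner_apply]
  congr 1
  · exact (inner_neg_left _ _).symm
  · rw [← Finset.sum_sub_distrib, Finset.mul_sum, PiLp.inner_apply]
    refine Finset.sum_congr rfl fun i _ => ?_
    simp [blk]
    ring

theorem tpred_smul (μ β : ℝ) (d t : Blk n m) : L.tpred μ d (β • t) =
    β * (-⟪L.gradf + L.B d.fst, t.fst⟫_ℝ +
      μ * (∑ i, t.snd i / L.y i - ∑ i, d.snd i * t.snd i / L.y i ^ 2)) -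
    1 / 2 * β ^ 2 * (⟪t.fst, L.B t.fst⟫_ℝ + μ * ∑ i, t.snd i ^ 2 / L.y i ^ 2) -
    1 / 3 * L.σ * (|β| * ‖L.scale t‖) ^ 3 := by
  have h1 : ∑ i, (β • t).snd i / L.y i = β * ∑ i, t.snd i / L.y i := by
    rw [Finset.mul_sum]
    exact Finset.sum_congr rfl fun i _ => by simp [mul_div_assoc]
  have h2 : ∑ i, d.snd i * (β • t).snd i / L.y i ^ 2 =
      β * ∑ i, d.snd i * t.snd i / L.y i ^ 2 := by
    rw [Finset.mul_sum]
    exact Finset.sum_congr rfl fun i _ => by simp; ring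
  have h3 : ∑ i, (β • t).snd i ^ 2 / L.y i ^ 2 = β ^ 2 * ∑ i, t.snd i ^ 2 / L.y i ^ 2 := by
    rw [Finset.mul_sum]
    exact Finset.sum_congr rfl fun i _ => by simp; ring
  unfold tpred
  rw [h1, h2, h3, norm_scale_smul, WithLp.smul_fst, map_smul, inner_smul_right, inner_smul_right,
    inner_smul_left]
  simp
  ring

theorem norm_scale_le_of_le {y₀ : ℝ} (hy₀ : 0 < y₀) (hy : ∀ i, y₀ ≤ L.y i) (d : Blk n m) :
    ‖L.scale d‖ ≤ (1 + m / y₀) * ‖d‖ := by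
  refine (norm_le_fst_add_snd _).trans ?_
  rw [add_mul, one_mul]
  refine add_le_add (norm_fst_le d) ?_
  rw [div_mul_eq_mul_div, mul_div_assoc]
  refine norm_le_card_mul _ fun i => ?_
  rw [scale_snd, abs_div, abs_of_pos (hy₀.trans_le (hy i))]
  exact div_le_div₀ (norm_nonneg _) ((abs_apply_le_norm _ _).trans (norm_snd_le d)) hy₀ (hy i)

theorem norm_tangDir_le {K μ M y₀ γN : ℝ} (hL : L.BoundedBy K) (hμ : 0 < μ)
    (hy₀ : 0 < y₀) (hy : ∀ i, y₀ ≤ L.y i) {N : Vec n →L[ℝ] Blk n m} (hN : ‖N‖ ≤ γN)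
    {d : Blk n m} (hd : ‖L.scale d‖ ≤ M) :
    ‖L.tangDir μ N d‖ ≤ γN * (K + K * M + m * (μ * ((1 + M) / y₀))) := by
  have hK := hL.one_le
  have hγN : 0 ≤ γN := (norm_nonneg _).trans hN
  unfold tangDir
  refine (ContinuousLinearMap.le_opNorm _ _).trans ?_
  rw [LinearIsometryEquiv.norm_map]
  refine mul_le_mul hN ((norm_le_fst_add_snd _).trans ?_) (norm_nonneg _) hγN
  refine add_le_add ?_ (norm_le_card_mul _ fun i => ?_)
  · rw [blk_fst, norm_neg]
    refine (norm_add_le _ _).trans (add_le_add hL.gradf ?_)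
    refine (L.B.le_opNorm _).trans ?_
    exact mul_le_mul hL.B ((L.norm_fst_le_scale d).trans hd) (norm_nonneg _) (by linarith)
  · have hyi : 0 < L.y i := hy₀.trans_le (hy i)
    have h1 : μ * (1 / L.y i - d.snd i / L.y i ^ 2) = μ * ((1 - d.snd i / L.y i) / L.y i) := by
      field_simp
    rw [blk_snd]
    change |μ * (1 / L.y i - d.snd i / L.y i ^ 2)| ≤ _
    rw [h1, abs_mul, abs_of_pos hμ, abs_div, abs_of_pos hyi]
    refine mul_le_mul_of_nonneg_left ?_ hμ.le
    have h2 := (L.abs_div_le_scale d i).trans hd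
    have h3 : |1 - d.snd i / L.y i| ≤ 1 + M := by
      rw [abs_le] at h2 ⊢
      constructor <;> linarith [h2.1, h2.2]
    exact div_le_div₀ ((abs_nonneg _).trans h3) h3 hy₀ (hy i)

/-- Sufficient tangential decrease, as long as `p_k^c` and the slacks are bounded away from
zero. -/
theorem exists_mul_min_le_tpred (n m : ℕ) {K μ ξ τ γt γN y₀ M ε : ℝ} (hK : 1 ≤ K)
    (hμ : 0 < μ) (hξ1 : ξ < 1) (hτ : 0 < τ) (hγt : 0 < γt) (hγN : 0 < γN)
    (hy₀ : 0 < y₀) (hM : 0 ≤ M) (hε : 0 < ε) :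
    ∃ κ > 0, ∀ (L : Local n m) (s : ℝ) (N : Vec n →L[ℝ] Blk n m) (d t : Blk n m),
      (∀ i, y₀ ≤ L.y i) → L.BoundedBy K → 0 < s → L.σ * s ^ 2 = 1 → ‖N‖ ≤ γN →
      ‖L.scale d‖ ≤ M → d ∈ L.normalFeasible ξ τ → ε ≤ ‖L.tangDir μ N d‖ →
      L.TangCauchyDecrease μ τ γt N d t → κ * min 1 s ≤ L.tpred μ d t := by
  set R := γN * (K + K * M + m * (μ * ((1 + M) / y₀))) with hR
  have hR0 : 0 < R := by positivity
  set C := (1 + m / y₀) * γN with hC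
  have hC0 : 0 < C := by positivity
  set β₀ := min (1 / (2 * ((K + μ) * C ^ 2))) ((1 - ξ) * τ / (C * R)) with hβ₀
  have hξ0 : 0 < 1 - ξ := by linarith
  have hβ₀pos : 0 < β₀ := lt_min (by positivity) (by positivity)
  set b := 1 / (2 * (1 + C ^ 3 * R)) with hb
  have hb0 : 0 < b := by positivity
  have hβ1 : β₀ * (2 * ((K + μ) * C ^ 2)) ≤ 1 := by
    rw [← le_div_iff₀ (by positivity)]
    exact min_le_left _ _
  have hβ2 : β₀ * (C * R) ≤ (1 - ξ) * τ := by
    rw [← le_div_iff₀ (by positivity)]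
    exact min_le_right _ _
  refine ⟨γt * (1 / 4 * min β₀ b * ε ^ 2), by have := lt_min hβ₀pos hb0; positivity, ?_⟩
  intro L s N d t hy hL hs hσs hN hdM hdf hεp hcauchy
  have hσ0 : 0 < L.σ := pos_of_mul_sq_eq_one hσs
  set p := L.tangDir μ N d with hp
  have hpR : ‖p‖ ≤ R := L.norm_tangDir_le hL hμ hy₀ hy hN hdM
  have hp0 : 0 < ‖p‖ := hε.trans_le hεp
  set β := min β₀ (b * s) with hβ
  have hβpos : 0 < β := lt_min hβ₀pos (by positivity)
  have hββ₀ : β ≤ β₀ := min_le_left _ _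
  have hβs : β ≤ b * s := min_le_right _ _
  have hDq : ‖L.scale (N p)‖ ≤ C * ‖p‖ := by
    refine (L.norm_scale_le_of_le hy₀ hy _).trans ?_
    rw [hC, mul_assoc]
    refine mul_le_mul_of_nonneg_left ?_ (by positivity)
    exact (N.le_opNorm p).trans (by gcongr)
  have hDq0 := norm_nonneg (L.scale (N p))
  have hmem : β ∈ L.tangLengths μ τ N d := by
    refine ⟨hβpos.le, fun i => ?_⟩
    have hyi : 0 < L.y i := hy₀.trans_le (hy i)
    have h1 := (abs_le.1 ((L.abs_div_le_scale (β • N p) i))).1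
    have h2 : ‖L.scale (β • N p)‖ ≤ (1 - ξ) * τ := by
      rw [norm_scale_smul, abs_of_pos hβpos]
      calc β * ‖L.scale (N p)‖ ≤ β₀ * (C * R) := by
            refine mul_le_mul hββ₀ (hDq.trans ?_) hDq0 hβ₀pos.le
            gcongr
        _ ≤ _ := hβ2
    have h3 : -((1 - ξ) * τ) ≤ (β • N p).snd i / L.y i := by linarith
    rw [le_div_iff₀ hyi] at h3
    have h4 := hdf i
    linarith
  have hdec : 1 / 4 * β * ‖p‖ ^ 2 ≤ L.tpred μ d (β • N p) := by
    rw [tpred_smul, L.inner_tangDir N d, ← hp, abs_of_pos hβpos]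
    have hDq2 : ‖L.scale (N p)‖ ^ 2 ≤ C ^ 2 * ‖p‖ ^ 2 :=
      (pow_le_pow_left₀ hDq0 hDq 2).trans_eq (by ring)
    have e1 : ⟪(N p).fst, L.B (N p).fst⟫_ℝ ≤ K * (C ^ 2 * ‖p‖ ^ 2) := by
      refine (le_abs_self _).trans ((L.abs_inner_apply_le hL.B _ _).trans ?_)
      refine mul_le_mul_of_nonneg_left (le_trans ?_ hDq2) (by linarith)
      rw [← sq]
      exact pow_le_pow_left₀ (norm_nonneg _) (L.norm_fst_le_scale _) 2
    have e2 : μ * ∑ i, (N p).snd i ^ 2 / L.y i ^ 2 ≤ μ * (C ^ 2 * ‖p‖ ^ 2) :=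
      mul_le_mul_of_nonneg_left ((L.sum_sq_div_sq_le _).trans hDq2) hμ.le
    have e3 : 1 / 2 * β ^ 2 * (⟪(N p).fst, L.B (N p).fst⟫_ℝ +
        μ * ∑ i, (N p).snd i ^ 2 / L.y i ^ 2) ≤ 1 / 4 * β * ‖p‖ ^ 2 := by
      calc _ ≤ 1 / 2 * β ^ 2 * (K * (C ^ 2 * ‖p‖ ^ 2) + μ * (C ^ 2 * ‖p‖ ^ 2)) := by gcongr
        _ = 1 / 4 * β * ‖p‖ ^ 2 * (β * (2 * ((K + μ) * C ^ 2))) := by ring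
        _ ≤ 1 / 4 * β * ‖p‖ ^ 2 * 1 := by
          refine mul_le_mul_of_nonneg_left (le_trans ?_ hβ1) (by positivity)
          gcongr
        _ = _ := mul_one _
    have e4 : 1 / 3 * L.σ * (β * ‖L.scale (N p)‖) ^ 3 ≤ 1 / 4 * β * ‖p‖ ^ 2 := by
      have hDq3 : ‖L.scale (N p)‖ ^ 3 ≤ C ^ 3 * R * ‖p‖ ^ 2 := by
        calc ‖L.scale (N p)‖ ^ 3 ≤ (C * ‖p‖) ^ 3 := pow_le_pow_left₀ hDq0 hDq 3
          _ = C ^ 3 * ‖p‖ * ‖p‖ ^ 2 := by ring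
          _ ≤ _ := by gcongr
      have hb2 := sq_mul_le_of_eq_one_div (by positivity : 0 ≤ C ^ 3 * R) hb
      calc 1 / 3 * L.σ * (β * ‖L.scale (N p)‖) ^ 3
          = 1 / 3 * L.σ * β * β ^ 2 * ‖L.scale (N p)‖ ^ 3 := by ring
        _ ≤ 1 / 3 * L.σ * β * (b * s) ^ 2 * (C ^ 3 * R * ‖p‖ ^ 2) := by gcongr
        _ = 1 / 3 * β * ‖p‖ ^ 2 * (b ^ 2 * (C ^ 3 * R)) * (L.σ * s ^ 2) := by ring
        _ = 1 / 3 * β * ‖p‖ ^ 2 * (b ^ 2 * (C ^ 3 * R)) := by rw [hσs, mul_one]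
        _ ≤ 1 / 3 * β * ‖p‖ ^ 2 * (1 / 4) := by gcongr
        _ ≤ _ := by
          have : 0 ≤ β * ‖p‖ ^ 2 := by positivity
          linarith
    have : 0 ≤ β * ‖p‖ ^ 2 := by positivity
    linarith
  obtain ⟨β', hβ', hmin, hle⟩ := hcauchy
  have h1 : -L.tpred μ d (β' • N p) ≤ -L.tpred μ d (β • N p) := hmin hmem
  refine le_trans ?_ hle
  rw [mul_assoc]
  refine mul_le_mul_of_nonneg_left ?_ hγt.le
  have h2 : min β₀ b * min 1 s ≤ β := by
    have e1 : min β₀ b ≤ β₀ := min_le_left _ _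
    have e2 : min β₀ b ≤ b := min_le_right _ _
    have e3 : min 1 s ≤ 1 := min_le_left _ _
    have e4 : min 1 s ≤ s := min_le_right _ _
    have e6 : 0 < min 1 s := lt_min one_pos hs
    refine le_min ?_ (mul_le_mul e2 e4 e6.le hb0.le)
    exact (mul_le_mul e1 e3 e6.le hβ₀pos.le).trans_eq (mul_one _)
  calc 1 / 4 * min β₀ b * ε ^ 2 * min 1 s = 1 / 4 * (min β₀ b * min 1 s) * ε ^ 2 := by ring
    _ ≤ 1 / 4 * β * ‖p‖ ^ 2 := by gcongr
    _ ≤ _ := by linarith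

end Local

/-! ### The iterates: merit function, potential and acceptance of steps -/

/-- A `C¹` map is differentiable at `x₀` uniformly in nearby base points. -/
theorem exists_norm_sub_fderiv_le {E F : Type*} [NormedAddCommGroup E] [NormedSpace ℝ E]
    [NormedAddCommGroup F] [NormedSpace ℝ F] {φ : E → F} (hφ : ContDiff ℝ 1 φ) (x₀ : E) {ω : ℝ}
    (hω : 0 < ω) :
    ∃ r > 0, ∀ x d, ‖x - x₀‖ < r → ‖d‖ < r → ‖φ (x + d) - φ x - fderiv ℝ φ x d‖ ≤ ω * ‖d‖ := by
  have h1 : HasStrictFDerivAt φ (fderiv ℝ φ x₀) x₀ :=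
    hφ.contDiffAt.hasStrictFDerivAt one_ne_zero
  obtain ⟨r₁, hr₁, hb₁⟩ := Metric.eventually_nhds_iff.1
    ((h1.isLittleO.def (by positivity : 0 < ω / 2)))
  obtain ⟨r₂, hr₂, hb₂⟩ := Metric.continuousAt_iff.1
    (hφ.continuous_fderiv one_ne_zero).continuousAt (ω / 2) (by positivity : 0 < ω / 2)
  refine ⟨min (r₁ / 2) r₂, by positivity, fun x d hx hd => ?_⟩
  have hx1 : ‖x - x₀‖ < r₁ / 2 := hx.trans_le (min_le_left _ _)
  have hd1 : ‖d‖ < r₁ / 2 := hd.trans_le (min_le_left _ _)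
  have e1 := @hb₁ (x + d, x) (by
    rw [Prod.dist_eq, max_lt_iff]
    constructor
    · rw [dist_eq_norm, add_sub_right_comm]
      exact (norm_add_le _ _).trans_lt (by linarith)
    · rw [dist_eq_norm]
      linarith)
  have e2 := @hb₂ x (by rw [dist_eq_norm]; exact hx.trans_le (min_le_right _ _))
  rw [dist_eq_norm] at e2
  simp only [add_sub_cancel_left] at e1
  have e3 : φ (x + d) - φ x - fderiv ℝ φ x d =
      (φ (x + d) - φ x - fderiv ℝ φ x₀ d) - (fderiv ℝ φ x - fderiv ℝ φ x₀) d := by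
    rw [sub_apply]
    abel
  rw [e3]
  refine (norm_sub_le _ _).trans ?_
  have e4 : ‖(fderiv ℝ φ x - fderiv ℝ φ x₀) d‖ ≤ ω / 2 * ‖d‖ :=
    (ContinuousLinearMap.le_opNorm _ _).trans (by gcongr)
  linarith

/-- The logarithm lies below a line of any given positive slope. -/
theorem exists_log_le_mul_add {a : ℝ} (ha : 0 < a) : ∃ C, ∀ y, 0 < y → Real.log y ≤ a * y + C := by
  refine ⟨-Real.log a, fun y hy => ?_⟩
  have h1 := Real.log_le_sub_one_of_pos (mul_pos ha hy)
  rw [Real.log_mul ha.ne' hy.ne'] at h1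
  linarith

namespace Seqs

variable {S : Seqs n m} {f : Vec n → ℝ} {g : Vec n → Vec m}
  {P : Params} {μ νinit : ℝ}

/-- The scale `σ_k ^ (-1/2)` of the steps. -/
noncomputable def stepScale (S : Seqs n m) (k : ℕ) : ℝ := (√(S.σ k))⁻¹

namespace IsRun

variable (hS : S.IsRun f g P μ νinit)

include hS

theorem stepScale_pos (k : ℕ) : 0 < S.stepScale k :=
  inv_pos.2 (Real.sqrt_pos.2 (hS.σ_pos k))

theorem sigma_mul_stepScale_sq (k : ℕ) : S.σ k * S.stepScale k ^ 2 = 1 := by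
  rw [stepScale, inv_pow, Real.sq_sqrt (hS.σ_pos k).le]
  exact mul_inv_cancel₀ (hS.σ_pos k).ne'

theorem neg_le_step_snd (k : ℕ) (i : Fin m) : -(P.τ * S.y k i) ≤ (S.step k).snd i :=
  (hS.tang_feasible k).2 i

theorem y_pos (k : ℕ) : ∀ i, 0 < S.y k i := by
  induction k with
  | zero => exact hS.y_zero_pos
  | succ k ih =>
    intro i
    by_cases h : P.η₁ ≤ S.rho f g μ k
    · rw [(hS.accept k h).2, PiLp.add_apply]
      have h1 := hS.neg_le_step_snd k i
      have h2 := mul_lt_mul_of_pos_right P.τ_lt_one (ih i)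
      linarith
    · rw [(hS.reject k (not_le.1 h)).2]
      exact ih i

theorem npred_nonneg (k : ℕ) : 0 ≤ (S.loc f g k).npred P.ξ (S.nStep k) :=
  (S.loc f g k).npred_nonneg (hS.y_pos k) (mul_pos P.ξ_pos P.τ_pos).le P.γn_pos (hS.normal_cauchy k)

theorem tpred_nonneg (k : ℕ) : 0 ≤ (S.loc f g k).tpred μ (S.nStep k) (S.tStep k) := by
  refine (S.loc f g k).tpred_nonneg P.γt_pos (fun i => ?_) (hS.tang_cauchy k)
  have h1 : -(P.ξ * P.τ * S.y k i) ≤ (S.nStep k).snd i := hS.normal_feasible k i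
  have h2 := mul_pos P.τ_pos (hS.y_pos k i)
  have h3 := mul_lt_mul_of_pos_right P.ξ_lt_one h2
  change -(P.τ * S.y k i) ≤ _
  linarith

theorem nu_succ (k : ℕ) : S.ν (k + 1) = S.ν k ∨ 3 / 2 * S.ν k ≤ S.ν (k + 1) := by
  rw [hS.ν_succ k, penaltyUpdate]
  split_ifs
  · exact Or.inl rfl
  · exact Or.inr (le_max_right _ _)

omit hS in
theorem le_penaltyUpdate (a b : ℝ) : b ≤ penaltyUpdate a b := by
  rw [penaltyUpdate]
  split_ifs with h
  · exact h
  · exact le_max_left _ _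

theorem nuTilde_le (k : ℕ) : S.nuTilde f g P μ k ≤ S.ν k := by
  cases k with
  | zero => rw [hS.ν_zero]; exact le_penaltyUpdate _ _
  | succ k => rw [hS.ν_succ k]; exact le_penaltyUpdate _ _

theorem nu_pos (k : ℕ) : 0 < S.ν k := by
  induction k with
  | zero =>
    rw [hS.ν_zero, penaltyUpdate]
    have := hS.νinit_pos
    split_ifs
    · exact this
    · exact lt_max_of_lt_right (by linarith)
  | succ k ih =>
    rcases hS.nu_succ k with h | h
    · rwa [h]
    · linarith

theorem nu_mono : Monotone S.ν :=
  monotone_nat_of_le_succ fun k => by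
    have := hS.nu_pos k
    rcases hS.nu_succ k with h | h
    · exact h.ge
    · linarith

theorem le_pred (k : ℕ) :
    S.ν k * (P.δ * (S.loc f g k).npred P.ξ (S.nStep k)) ≤
        (S.loc f g k).pred μ (S.ν k) (S.step k) ∧
      (S.loc f g k).tpred μ (S.nStep k) (S.tStep k) + (S.loc f g k).chi μ (S.nStep k) +
        S.ν k * (1 / 2 * (S.loc f g k).npred P.ξ (S.nStep k)) ≤
        (S.loc f g k).pred μ (S.ν k) (S.step k) :=
  (S.loc f g k).le_pred_of_nuTilde_le (hS.y_pos k) (hS.σ_pos k) (hS.B_symm k) P.ξ_pos P.δ_lt_one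
    (hS.tang_feasible k).1 (hS.npred_nonneg k) (hS.tpred_nonneg k) (hS.nuTilde_le k)

theorem pred_nonneg (k : ℕ) : 0 ≤ (S.loc f g k).pred μ (S.ν k) (S.step k) := by
  refine le_trans ?_ (hS.le_pred k).1
  have := hS.nu_pos k
  have := P.δ_pos
  have := hS.npred_nonneg k
  positivity

theorem mul_pred_le_ared (k : ℕ) (h : P.η₁ ≤ S.rho f g μ k) :
    P.η₁ * (S.loc f g k).pred μ (S.ν k) (S.step k) ≤ S.ared f g μ k := by
  rcases (hS.pred_nonneg k).eq_or_lt with h0 | h0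
  · rw [rho, ← h0, div_zero] at h
    exact absurd h (not_le.2 P.η₁_pos)
  · rwa [rho, le_div_iff₀ h0] at h

theorem merit_succ_le (k : ℕ) :
    merit f g μ (S.ν k) (S.x (k + 1)) (S.y (k + 1)) ≤ merit f g μ (S.ν k) (S.x k) (S.y k) ∧
    (P.η₁ ≤ S.rho f g μ k → P.η₁ * (S.loc f g k).pred μ (S.ν k) (S.step k) ≤
      merit f g μ (S.ν k) (S.x k) (S.y k) - merit f g μ (S.ν k) (S.x (k + 1)) (S.y (k + 1))) := by
  by_cases h : P.η₁ ≤ S.rho f g μ k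
  · have h1 := hS.mul_pred_le_ared k h
    have h2 := mul_nonneg P.η₁_pos.le (hS.pred_nonneg k)
    unfold ared at h1
    rw [(hS.accept k h).1, (hS.accept k h).2]
    exact ⟨by linarith, fun _ => h1⟩
  · rw [(hS.reject k (not_le.1 h)).1, (hS.reject k (not_le.1 h)).2]
    exact ⟨le_rfl, fun h' => absurd h' h⟩

/-- The barrier function is bounded below up to a small multiple of the infeasibility, because large
slacks entail a large infeasibility. -/
theorem exists_barrier_ge (h2 : S.A2 f g) (hμ : 0 < μ) {ε : ℝ} (hε : 0 < ε) :
    ∃ C, ∀ k, -C - ε * ‖g (S.x k) + S.y k‖ ≤ f (S.x k) - μ * ∑ i, Real.log (S.y k i) := by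
  obtain ⟨⟨Cf, hCf⟩, -, ⟨Cg, hCg⟩, -, -⟩ := h2
  have ha : 0 < ε / (μ * (m + 1)) := by positivity
  obtain ⟨C₁, hC₁⟩ := exists_log_le_mul_add ha
  refine ⟨-Cf + ε * Cg + μ * (m * C₁), fun k => ?_⟩
  have h1 : ‖S.y k‖ ≤ ‖g (S.x k) + S.y k‖ + Cg := by
    have : S.y k = (g (S.x k) + S.y k) - g (S.x k) := by abel
    calc ‖S.y k‖ = ‖(g (S.x k) + S.y k) - g (S.x k)‖ := by rw [← this]
      _ ≤ _ := (norm_sub_le _ _).trans (by linarith [hCg k])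
  have h3 : ∑ i, Real.log (S.y k i) ≤ m * (ε / (μ * (m + 1)) * ‖S.y k‖ + C₁) := by
    calc ∑ i, Real.log (S.y k i) ≤ ∑ _i : Fin m, (ε / (μ * (m + 1)) * ‖S.y k‖ + C₁) := by
          refine Finset.sum_le_sum fun i _ => (hC₁ _ (hS.y_pos k i)).trans ?_
          have := (le_abs_self _).trans (abs_apply_le_norm (S.y k) i)
          gcongr
      _ = _ := by simp [mul_add]
  have h4 := mul_le_mul_of_nonneg_left h3 hμ.le
  have h5 : μ * (m * (ε / (μ * (m + 1)) * ‖S.y k‖ + C₁)) =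
      ε * ‖S.y k‖ * (m / (m + 1)) + μ * (m * C₁) := by
    field_simp
  have h6 : ε * ‖S.y k‖ * (m / (m + 1)) ≤ ε * ‖S.y k‖ := by
    have : (m : ℝ) / (m + 1) ≤ 1 := by
      rw [div_le_one (by positivity)]
      linarith
    exact mul_le_of_le_one_right (by positivity) this
  have h7 := mul_le_mul_of_nonneg_left h1 hε.le
  have := hCf k
  linarith

/-- A potential that decreases along the run, even where the penalty parameter grows: the merit
function, shifted by the lower bound of the barrier function and divided by the penalty parameter
less the part of it used up by that bound. -/
theorem exists_potential (h2 : S.A2 f g) (hμ : 0 < μ) :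
    ∃ Ψ : ℕ → ℝ, Antitone Ψ ∧ (∀ k, ‖g (S.x k) + S.y k‖ ≤ Ψ k) ∧
      ∀ k, P.η₁ ≤ S.rho f g μ k →
        P.η₁ * ((S.loc f g k).pred μ (S.ν k) (S.step k) / (1 + S.ν k)) ≤ Ψ k - Ψ (k + 1) := by
  have hν0 := hS.nu_pos 0
  set ε := S.ν 0 / 2 with hε
  obtain ⟨C, hC⟩ := hS.exists_barrier_ge h2 hμ (by positivity : 0 < ε)
  have hνε : ∀ k, 0 < S.ν k - ε := fun k => by
    have := hS.nu_mono (Nat.zero_le k)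
    linarith
  set V : ℕ → ℝ := fun k => f (S.x k) - μ * ∑ i, Real.log (S.y k i) + C with hV
  set a : ℕ → ℝ := fun k => ‖g (S.x k) + S.y k‖ with ha
  have hVa : ∀ k, 0 ≤ V k + ε * a k := fun k => by
    have := hC k
    simp only [hV, ha]
    linarith
  set Ψ : ℕ → ℝ := fun k => (V k + ε * a k) / (S.ν k - ε) + a k with hΨ
  have hmid : ∀ k, Ψ (k + 1) ≤ (V (k + 1) + ε * a (k + 1)) / (S.ν k - ε) + a (k + 1) := fun k => by
    have h1 := hS.nu_mono (Nat.le_succ k)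
    have : (V (k + 1) + ε * a (k + 1)) / (S.ν (k + 1) - ε) ≤
        (V (k + 1) + ε * a (k + 1)) / (S.ν k - ε) :=
      div_le_div_of_nonneg_left (hVa _) (hνε k) (by linarith)
    simp only [hΨ]
    linarith
  have hform : ∀ k j, (V j + ε * a j) / (S.ν k - ε) + a j = (V j + S.ν k * a j) / (S.ν k - ε) := by
    intro k j
    have := (hνε k).ne'
    field_simp
    ring
  have hmerit : ∀ k j, V j + S.ν k * a j = merit f g μ (S.ν k) (S.x j) (S.y j) + C := by
    intro k j
    simp only [hV, ha, merit]
    ring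
  have hdiff : ∀ k, (merit f g μ (S.ν k) (S.x k) (S.y k) -
      merit f g μ (S.ν k) (S.x (k + 1)) (S.y (k + 1))) / (S.ν k - ε) ≤ Ψ k - Ψ (k + 1) := by
    intro k
    have h1 := hmid k
    have h3 : Ψ k = (V k + S.ν k * a k) / (S.ν k - ε) := hform k k
    rw [hform k (k + 1), hmerit] at h1
    rw [h3, hmerit, sub_div]
    rw [add_div] at h1 ⊢
    linarith
  refine ⟨Ψ, antitone_nat_of_succ_le fun k => ?_, fun k => ?_, fun k hk => ?_⟩
  · have h1 := hdiff k
    have h3 := div_nonneg (sub_nonneg.2 (hS.merit_succ_le k).1) (hνε k).le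
    linarith
  · have := div_nonneg (hVa k) (hνε k).le
    simp only [hΨ]
    linarith
  · refine le_trans ?_ (hdiff k)
    have h1 := (hS.merit_succ_le k).2 hk
    have h3 := hS.pred_nonneg k
    rw [← mul_div_assoc]
    exact div_le_div₀ ((mul_nonneg P.η₁_pos.le h3).trans h1) h1 (hνε k) (by linarith)

theorem exists_boundedBy (h2 : S.A2 f g) (hμ : 0 < μ) : ∃ K, ∀ k, (S.loc f g k).BoundedBy K := by
  obtain ⟨Ψ, hΨ, hΨa, -⟩ := hS.exists_potential h2 hμ
  obtain ⟨-, ⟨C₁, h1⟩, ⟨C₂, h2⟩, ⟨C₃, h3⟩, ⟨C₄, h4⟩⟩ := h2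
  have hpos : ∀ C : ℝ, C ≤ |C| := le_abs_self
  have hres : ∀ k, ‖g (S.x k) + S.y k‖ ≤ |Ψ 0| := fun k =>
    (hΨa k).trans ((hΨ (Nat.zero_le k)).trans (hpos _))
  refine ⟨1 + |C₁| + |C₂| + |C₃| + |C₄| + |Ψ 0|, fun k => ?_⟩
  have p1 := abs_nonneg C₁
  have p2 := abs_nonneg C₂
  have p3 := abs_nonneg C₃
  have p4 := abs_nonneg C₄
  have p5 := abs_nonneg (Ψ 0)
  refine ⟨by linarith, ?_, ?_, ?_, ?_, ?_⟩
  · exact (h1 k).trans (by linarith [hpos C₁])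
  · exact (hres k).trans (by linarith)
  · exact (h3 k).trans (by linarith [hpos C₃])
  · have : S.y k = (g (S.x k) + S.y k) - g (S.x k) := by abel
    change ‖S.y k‖ ≤ _
    rw [this]
    exact (norm_sub_le _ _).trans (by linarith [hres k, h2 k, hpos C₂])
  · exact (h4 k).trans (by linarith [hpos C₄])

omit hS in
theorem exists_le_scaledAdj (hsv : S.JacobianBoundedAway g) :
    ∃ γ > 0, ∀ k v, γ * ‖v‖ ≤ ‖(S.loc f g k).scaledAdj v‖ := by
  obtain ⟨γ, hγ, h⟩ := hsv
  refine ⟨γ, hγ, fun k v => ?_⟩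
  rw [← Local.adjoint_scaledJac]
  have hE : Module.finrank ℝ (Vec m) = m := by simp
  refine le_norm_adjoint_of_le_singularValues _ hγ ?_ (fun i hi => h k i (hE ▸ hi)) v
  have : Module.finrank ℝ (Blk n m) = n + m := by
    rw [(WithLp.linearEquiv 2 ℝ (Vec n × Vec m)).finrank_eq, Module.finrank_prod]
    simp
  rw [this, hE]
  omega

/-- If `σ_k ≥ 1`, the scaled trial step is at most of the order of `σ_k ^ (-1/2)`. -/
theorem exists_norm_scale_step_le (hμ : 0 < μ) {K : ℝ} (hK : ∀ k, (S.loc f g k).BoundedBy K) :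
    ∃ Q > 0, ∀ k, S.stepScale k ≤ 1 →
      ‖(S.loc f g k).scale (S.step k)‖ ≤ Q * S.stepScale k := by
  have hK1 := (hK 0).one_le
  have hμm : 0 ≤ μ * m := by positivity
  refine ⟨6 * K + (3 * (K + μ * m) * (1 + 6 * K) + 3 * (K + μ * m)), by positivity,
    fun k hk => ?_⟩
  have hs := hS.stepScale_pos k
  have hn := (S.loc f g k).norm_scale_normal_le (hS.y_pos k) (hS.σ_pos k) (hK k) P.ξ_pos P.ξ_lt_one
    hs (hS.sigma_mul_stepScale_sq k) (hS.npred_nonneg k)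
  have hn' : ‖(S.loc f g k).scale (S.nStep k)‖ ≤ 6 * K := hn.trans (by nlinarith)
  have ht := (S.loc f g k).norm_scale_tang_le (hK k) hμ (by linarith) hs hk
    (hS.sigma_mul_stepScale_sq k) hn' (hS.tpred_nonneg k)
  rw [step, Local.scale_add, add_mul]
  exact (norm_add_le _ _).trans (add_le_add hn ht)

/-- The predicted reduction exceeds the actual one by at most the errors of the first order Taylor
expansions of `f` and `g` and a quadratic term. -/
theorem pred_sub_ared_le (hμ : 0 < μ) {K : ℝ} (hK : ∀ k, (S.loc f g k).BoundedBy K) (k : ℕ) :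
    (S.loc f g k).pred μ (S.ν k) (S.step k) - S.ared f g μ k ≤
      ‖f (S.x k + (S.step k).fst) - f (S.x k) - fderiv ℝ f (S.x k) (S.step k).fst‖ +
      S.ν k * ‖g (S.x k + (S.step k).fst) - g (S.x k) - fderiv ℝ g (S.x k) (S.step k).fst‖ +
      (K + μ / (1 - P.τ)) * ‖(S.loc f g k).scale (S.step k)‖ ^ 2 := by
  set L := S.loc f g k with hL
  set d := S.step k with hd
  have hτ : 0 < 1 - P.τ := by linarith [P.τ_lt_one]
  have hy : ∀ i, 0 < L.y i := hS.y_pos k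
  have hgrad : fderiv ℝ f (S.x k) d.fst = ⟪L.gradf, d.fst⟫_ℝ := by
    change _ = ⟪gradient f (S.x k), d.fst⟫_ℝ
    rw [gradient, InnerProductSpace.toDual_symm_apply]
  have hjac : jac L.A d = fderiv ℝ g (S.x k) d.fst + d.snd := by
    rw [jac_apply]
    change ContinuousLinearMap.adjoint (conGrad g (S.x k)) _ + _ = _
    rw [conGrad, ContinuousLinearMap.adjoint_adjoint]
  have ef := neg_le_abs (f (S.x k + d.fst) - f (S.x k) - fderiv ℝ f (S.x k) d.fst)
  have ef' := le_abs_self (f (S.x k + d.fst) - f (S.x k) - fderiv ℝ f (S.x k) d.fst)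
  have eg : ‖g (S.x k + d.fst) + (S.y k + d.snd)‖ ≤ ‖L.res + jac L.A d‖ +
      ‖g (S.x k + d.fst) - g (S.x k) - fderiv ℝ g (S.x k) d.fst‖ := by
    have : g (S.x k + d.fst) + (S.y k + d.snd) = (L.res + jac L.A d) +
        (g (S.x k + d.fst) - g (S.x k) - fderiv ℝ g (S.x k) d.fst) := by
      rw [hjac]
      change _ = (g (S.x k) + S.y k) + _ + _
      abel
    rw [this]
    exact norm_add_le _ _
  have eB : -(1 / 2 * ⟪d.fst, L.B d.fst⟫_ℝ) ≤ K * ‖L.scale d‖ ^ 2 := by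
    have h1 := (neg_le_abs _).trans (L.abs_inner_apply_le (hK k).B d.fst d.fst)
    have h3 := (hK k).one_le
    have h2 : K * (‖d.fst‖ * ‖d.fst‖) ≤ K * ‖L.scale d‖ ^ 2 := by
      rw [sq]
      have := L.norm_fst_le_scale d
      gcongr
    have h4 : 0 ≤ K * ‖L.scale d‖ ^ 2 := by positivity
    linarith
  have elog : ∑ i, Real.log (S.y k i) + ∑ i, d.snd i / L.y i - ‖L.scale d‖ ^ 2 / (1 - P.τ) ≤
      ∑ i, Real.log ((S.y k + d.snd) i) := by
    have h1 := div_le_div_of_nonneg_right (L.sum_sq_div_sq_le d) hτ.le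
    have h2 : ∑ i, (Real.log (S.y k i) + d.snd i / L.y i - d.snd i ^ 2 / L.y i ^ 2 / (1 - P.τ)) ≤
        ∑ i, Real.log ((S.y k + d.snd) i) := by
      refine Finset.sum_le_sum fun i _ => ?_
      have hyi := hy i
      have h3 : -P.τ ≤ d.snd i / L.y i := by
        rw [le_div_iff₀ hyi]
        have := hS.neg_le_step_snd k i
        change _ ≤ d.snd i
        linarith [show P.τ * S.y k i = P.τ * L.y i from rfl]
      have h4 := sub_sq_div_le_log P.τ_lt_one h3
      have h5 : (S.y k + d.snd) i = L.y i * (1 + d.snd i / L.y i) := by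
        rw [mul_add, mul_one, mul_div_cancel₀ _ hyi.ne']
        rfl
      rw [h5, Real.log_mul hyi.ne' (by linarith [P.τ_lt_one])]
      rw [div_pow] at h4
      change Real.log (L.y i) + _ - _ ≤ _
      linarith
    rw [Finset.sum_sub_distrib, Finset.sum_add_distrib, ← Finset.sum_div] at h2
    linarith
  have elog' := mul_le_mul_of_nonneg_left elog hμ.le
  have eg' := mul_le_mul_of_nonneg_left eg (hS.nu_pos k).le
  have ecub : 0 ≤ 1 / 3 * L.σ * ‖L.scale d‖ ^ 3 := by
    have : 0 < L.σ := hS.σ_pos k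
    positivity
  have esq : 0 ≤ μ * ∑ i, d.snd i ^ 2 / L.y i ^ 2 := mul_nonneg hμ.le (L.sum_sq_div_sq_nonneg d)
  have hres : L.res = g (S.x k) + S.y k := rfl
  have hpred : L.pred μ (S.ν k) d = S.ν k * ‖g (S.x k) + S.y k‖ -
      (⟪L.gradf, d.fst⟫_ℝ + 1 / 2 * ⟪d.fst, L.B d.fst⟫_ℝ + 1 / 3 * L.σ * ‖L.scale d‖ ^ 3
        - μ * (∑ i, d.snd i / L.y i - 1 / 2 * ∑ i, d.snd i ^ 2 / L.y i ^ 2)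
        + S.ν k * ‖L.res + jac L.A d‖) := by
    unfold Local.pred Local.model
    simp [hres]
  have hsplit : (K + μ / (1 - P.τ)) * ‖L.scale d‖ ^ 2 =
      K * ‖L.scale d‖ ^ 2 + μ * (‖L.scale d‖ ^ 2 / (1 - P.τ)) := by ring
  rw [hpred, ared, merit, merit, ← hd, hsplit, Real.norm_eq_abs]
  rw [hgrad] at ef ef' ⊢
  linarith

/-- Where the iterates converge, sufficiently small steps with sufficient predicted reduction are
very successful. -/
theorem exists_very_successful (hf : ContDiff ℝ 1 f) (hg : ContDiff ℝ 1 g) (h2 : S.A2 f g)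
    (hμ : 0 < μ) {x₀ : Vec n} (hx₀ : Tendsto S.x atTop (𝓝 x₀)) {κ : ℝ} (hκ : 0 < κ) :
    ∃ r > 0, ∃ K₀, ∀ k ≥ K₀,
      κ * ((1 + S.ν k) * min 1 (S.stepScale k)) ≤ (S.loc f g k).pred μ (S.ν k) (S.step k) →
      S.stepScale k ≤ r → P.η₂ ≤ S.rho f g μ k := by
  obtain ⟨K, hK⟩ := hS.exists_boundedBy h2 hμ
  obtain ⟨Q, hQ, hQs⟩ := hS.exists_norm_scale_step_le hμ hK
  have hη : 0 < 1 - P.η₂ := by linarith [P.η₂_lt_one]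
  have hτ : 0 < 1 - P.τ := by linarith [P.τ_lt_one]
  set C := K + μ / (1 - P.τ) with hC
  have hK1 := (hK 0).one_le
  have hC0 : 0 < C := by positivity
  set c := (1 - P.η₂) * κ / 2 with hc
  have hc0 : 0 < c := by positivity
  set ω := c / Q with hω
  have hω0 : 0 < ω := by positivity
  have hωQ : ω * Q = c := by rw [hω]; field_simp
  obtain ⟨r₁, hr₁, hf₁⟩ := exists_norm_sub_fderiv_le hf x₀ hω0
  obtain ⟨r₂, hr₂, hg₂⟩ := exists_norm_sub_fderiv_le hg x₀ hω0
  obtain ⟨K₀, hK₀⟩ := Metric.tendsto_atTop.1 hx₀ (min r₁ r₂) (lt_min hr₁ hr₂)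
  set r := min 1 (min (min r₁ r₂ / (2 * Q)) (c / (C * Q ^ 2))) with hr
  have hr0 : 0 < r := lt_min one_pos (lt_min (by positivity) (by positivity))
  refine ⟨r, hr0, K₀, fun k hk hpred hsr => ?_⟩
  set s := S.stepScale k with hs
  have hs0 : 0 < s := hS.stepScale_pos k
  have hs1 : s ≤ 1 := hsr.trans (min_le_left _ _)
  have hs2 : s * (2 * Q) ≤ min r₁ r₂ := by
    rw [← le_div_iff₀ (by positivity)]
    exact hsr.trans ((min_le_right _ _).trans (min_le_left _ _))
  have hs3 : s * (C * Q ^ 2) ≤ c := by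
    rw [← le_div_iff₀ (by positivity)]
    exact hsr.trans ((min_le_right _ _).trans (min_le_right _ _))
  rw [min_eq_right hs1] at hpred
  have hν := hS.nu_pos k
  have hpos : 0 < (S.loc f g k).pred μ (S.ν k) (S.step k) := lt_of_lt_of_le (by positivity) hpred
  rw [rho, le_div_iff₀ hpos]
  have hD := hQs k hs1
  have hdx : ‖(S.step k).fst‖ ≤ Q * s := ((S.loc f g k).norm_fst_le_scale _).trans hD
  have hdr : ‖(S.step k).fst‖ < min r₁ r₂ := by
    refine hdx.trans_lt (lt_of_lt_of_le ?_ hs2)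
    nlinarith [mul_pos hQ hs0]
  have hxr := hK₀ k hk
  rw [dist_eq_norm] at hxr
  have e1 := hf₁ _ _ (hxr.trans_le (min_le_left _ _)) (hdr.trans_le (min_le_left _ _))
  have e2 := hg₂ _ _ (hxr.trans_le (min_le_right _ _)) (hdr.trans_le (min_le_right _ _))
  have e3 := hS.pred_sub_ared_le hμ hK k
  have e4 : ω * ‖(S.step k).fst‖ ≤ c * s := by
    calc ω * ‖(S.step k).fst‖ ≤ ω * (Q * s) := by gcongr
      _ = c * s := by rw [← mul_assoc, hωQ]
  have e5 : C * ‖(S.loc f g k).scale (S.step k)‖ ^ 2 ≤ c * s := by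
    calc C * ‖(S.loc f g k).scale (S.step k)‖ ^ 2 ≤ C * (Q * s) ^ 2 := by gcongr
      _ = s * (C * Q ^ 2) * s := by ring
      _ ≤ _ := by gcongr
  have e6 := mul_le_mul_of_nonneg_left (e2.trans e4) hν.le
  have e7 := mul_le_mul_of_nonneg_left hpred hη.le
  have e8 : (1 - P.η₂) * (κ * ((1 + S.ν k) * s)) = 2 * (c * s) + 2 * (S.ν k * (c * s)) := by
    rw [hc]
    ring
  have e9 : 0 ≤ S.ν k * (c * s) := by positivity
  linarith [e1.trans e4]

theorem stepScale_le_succ (k : ℕ) (h : P.η₂ ≤ S.rho f g μ k) :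
    S.stepScale k ≤ S.stepScale (k + 1) :=
  inv_anti₀ (Real.sqrt_pos.2 (hS.σ_pos _)) (Real.sqrt_le_sqrt (hS.σ_very_successful k h))

theorem inv_sqrt_mul_stepScale_le (k : ℕ) (h : ¬ P.η₂ ≤ S.rho f g μ k) :
    (√P.γ₂)⁻¹ * S.stepScale k ≤ S.stepScale (k + 1) := by
  have hγ₂ : 0 < P.γ₂ := by linarith [P.one_lt_γ₁, P.γ₁_lt_γ₂]
  have h1 : S.σ (k + 1) ≤ P.γ₂ * S.σ k := by
    by_cases h' : P.η₁ ≤ S.rho f g μ k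
    · exact (hS.σ_successful k h' (not_le.1 h)).2.trans
        (mul_le_mul_of_nonneg_right P.γ₁_lt_γ₂.le (hS.σ_pos k).le)
    · exact (hS.σ_unsuccessful k (not_le.1 h')).2
  rw [stepScale, stepScale, ← mul_inv, ← Real.sqrt_mul hγ₂.le]
  exact inv_anti₀ (Real.sqrt_pos.2 (hS.σ_pos _)) (Real.sqrt_le_sqrt h1)

theorem stepScale_succ_le (k : ℕ) (h : ¬ P.η₁ ≤ S.rho f g μ k) :
    S.stepScale (k + 1) ≤ (√P.γ₁)⁻¹ * S.stepScale k := by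
  have hγ₁ : 0 < P.γ₁ := by linarith [P.one_lt_γ₁]
  rw [stepScale, stepScale, ← mul_inv, ← Real.sqrt_mul hγ₁.le]
  exact inv_anti₀ (Real.sqrt_pos.2 (mul_pos hγ₁ (hS.σ_pos _)))
    (Real.sqrt_le_sqrt (hS.σ_unsuccessful k (not_le.1 h)).1)

/-- A stationarity measure that is Lipschitz along the iterates tends to zero if the predicted
reduction is sufficient where it is bounded away from zero. -/
theorem tendsto_zero_of_le_pred (hf : ContDiff ℝ 1 f) (hg : ContDiff ℝ 1 g) (h2 : S.A2 f g)
    (hμ : 0 < μ) (θ : ℕ → ℝ) (hθ : ∀ k, 0 ≤ θ k)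
    (hrej : ∀ k, S.x (k + 1) = S.x k → S.y (k + 1) = S.y k → θ (k + 1) = θ k)
    (hlip : ∃ C, ∃ K₀, ∀ k ≥ K₀, S.x (k + 1) = S.x k + (S.step k).fst →
      S.y (k + 1) = S.y k + (S.step k).snd →
      |θ (k + 1) - θ k| ≤ C * ‖(S.loc f g k).scale (S.step k)‖)
    (hdec : ∀ ε > 0, ∃ κ > 0, ∃ K₀, ∀ k ≥ K₀, ε ≤ θ k →
      κ * ((1 + S.ν k) * min 1 (S.stepScale k)) ≤ (S.loc f g k).pred μ (S.ν k) (S.step k)) :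
    Tendsto θ atTop (𝓝 0) := by
  obtain ⟨Ψ, hΨ, hΨa, hΨd⟩ := hS.exists_potential h2 hμ
  obtain ⟨K, hK⟩ := hS.exists_boundedBy h2 hμ
  obtain ⟨Q, hQ, hQs⟩ := hS.exists_norm_scale_step_le hμ hK
  obtain ⟨C, K₀, hC⟩ := hlip
  have hγ₂ : 0 < √P.γ₂ := Real.sqrt_pos.2 (by linarith [P.one_lt_γ₁, P.γ₁_lt_γ₂])
  have hγ₁ : 1 < √P.γ₁ := by
    rw [Real.lt_sqrt zero_le_one]
    linarith [P.one_lt_γ₁]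
  refine tendsto_zero_of_sufficient_decrease S.x Ψ θ S.stepScale
    (fun k => P.η₁ ≤ S.rho f g μ k) (fun k => P.η₂ ≤ S.rho f g μ k) (K₀ := K₀)
    (c₁ := (√P.γ₁)⁻¹) (c₂ := (√P.γ₂)⁻¹) (C := (1 + |C|) * Q) (by positivity)
    (inv_lt_one_of_one_lt₀ hγ₁) (by positivity) (by positivity)
    (fun k => (norm_nonneg _).trans (hΨa k)) hΨ hθ hS.stepScale_pos hS.stepScale_le_succ
    hS.inv_sqrt_mul_stepScale_le hS.stepScale_succ_le (fun k hk => (hS.reject k (not_le.1 hk)).1)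
    (fun k hk => hrej k (hS.reject k (not_le.1 hk)).1 (hS.reject k (not_le.1 hk)).2) ?_ ?_ ?_ ?_
  · intro k _ hacc hs
    rw [(hS.accept k hacc).1, add_sub_cancel_left]
    refine ((S.loc f g k).norm_fst_le_scale _).trans ((hQs k hs).trans ?_)
    have := mul_pos hQ (hS.stepScale_pos k)
    nlinarith [abs_nonneg C]
  · intro k hk hacc hs
    refine (hC k hk (hS.accept k hacc).1 (hS.accept k hacc).2).trans ?_
    calc C * ‖(S.loc f g k).scale (S.step k)‖ ≤ (1 + |C|) * ‖(S.loc f g k).scale (S.step k)‖ := by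
          gcongr
          linarith [le_abs_self C]
      _ ≤ (1 + |C|) * (Q * S.stepScale k) := by
          have := hQs k hs
          gcongr
      _ = _ := by ring
  · intro ε hε
    obtain ⟨κ, hκ, K₁, hK₁⟩ := hdec ε hε
    refine ⟨P.η₁ * κ, mul_pos P.η₁_pos hκ, K₁, fun k hk hacc hθk => ?_⟩
    refine le_trans ?_ (hΨd k hacc)
    rw [mul_assoc]
    refine mul_le_mul_of_nonneg_left ?_ P.η₁_pos.le
    rw [le_div_iff₀ (by linarith [hS.nu_pos k])]
    have := hK₁ k hk hθk
    linarith
  · intro x₀ hx₀ ε hε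
    obtain ⟨κ, hκ, K₁, hK₁⟩ := hdec ε hε
    obtain ⟨r, hr, K₂, hK₂⟩ := hS.exists_very_successful hf hg h2 hμ hx₀ hκ
    exact ⟨r, hr, max K₁ K₂, fun k hk hθk hs =>
      hK₂ k (le_trans (le_max_right _ _) hk) (hK₁ k (le_trans (le_max_left _ _) hk) hθk) hs⟩

end IsRun

end Seqs

/-! ### Convergence: feasibility, penalty parameter, dual residual -/

namespace Local

variable (L : Local n m)

/-- The dual residual `∇f + μ A Y⁻¹ e`. -/
noncomputable def dualResidual (μ : ℝ) : Vec n :=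
  L.gradf + L.A (μ • WithLp.toLp 2 fun i => (L.y i)⁻¹)

/-- Close to a zero normal step, `p_k^c` controls the dual residual: both `N_x` and its transpose
are bounded below, because `N_x` is square and `N_y = -Aᵀ N_x`. -/
theorem norm_dualResidual_le {K μ y₀ γN : ℝ} (hL : L.BoundedBy K) (hμ : 0 < μ) (hy₀ : 0 < y₀)
    (hy : ∀ i, y₀ ≤ L.y i) (hγN : 0 < γN) {N : Vec n →L[ℝ] Blk n m}
    (hN : ∀ w, γN⁻¹ * ‖w‖ ≤ ‖N w‖) (hker : ∀ w, jac L.A (N w) = 0) (d : Blk n m) :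
    ‖L.dualResidual μ‖ ≤ γN * (1 + K) * ‖L.tangDir μ N d‖ +
      (K + K * (m * (μ / y₀))) * ‖L.scale d‖ := by
  have hK := hL.one_le
  set v := L.dualResidual μ with hv
  have hAt : ∀ w, ‖ContinuousLinearMap.adjoint L.A w‖ ≤ K * ‖w‖ := fun w => by
    refine (ContinuousLinearMap.le_opNorm _ _).trans ?_
    rw [LinearIsometryEquiv.norm_map]
    exact mul_le_mul_of_nonneg_right hL.A (norm_nonneg _)
  have hsnd : ∀ w, (N w).snd = -ContinuousLinearMap.adjoint L.A (N w).fst := fun w => by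
    have := hker w
    rw [jac_apply] at this
    exact (neg_eq_of_add_eq_zero_right this).symm
  have hlow : ∀ w, ‖w‖ ≤ γN * (1 + K) * ‖(N w).fst‖ := fun w => by
    have h1 : ‖N w‖ ≤ (1 + K) * ‖(N w).fst‖ := by
      refine (norm_le_fst_add_snd _).trans ?_
      rw [hsnd, norm_neg, add_mul, one_mul]
      exact add_le_add le_rfl (hAt _)
    have h2 := mul_le_mul_of_nonneg_left ((hN w).trans h1) hγN.le
    rw [← mul_assoc, mul_inv_cancel₀ hγN.ne', one_mul] at h2
    linarith
  have hinj : Function.Injective (WithLp.fstₗ 2 ℝ (Vec n) (Vec m) ∘ₗ N.toLinearMap) := by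
    rw [injective_iff_map_eq_zero]
    intro w hw
    have h0 : (N w).fst = 0 := hw
    have := hlow w
    rw [h0, norm_zero, mul_zero] at this
    exact norm_le_zero_iff.1 this
  obtain ⟨u, hu⟩ := LinearMap.injective_iff_surjective.1 hinj (-v)
  have hu' : (N u).fst = -v := hu
  have hunorm : ‖u‖ ≤ γN * (1 + K) * ‖v‖ := by
    have := hlow u
    rwa [hu', norm_neg] at this
  set z : Vec m := WithLp.toLp 2 fun i => μ * (d.snd i / L.y i ^ 2) with hz
  have hznorm : ‖z‖ ≤ m * (μ / y₀) * ‖L.scale d‖ := by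
    rw [mul_assoc]
    refine norm_le_card_mul _ fun i => ?_
    have hyi : 0 < L.y i := hy₀.trans_le (hy i)
    have h1 : z i = μ / L.y i * (d.snd i / L.y i) := by
      simp only [hz]
      field_simp
    rw [h1, abs_mul, abs_of_pos (by positivity)]
    exact mul_le_mul (div_le_div_of_nonneg_left hμ.le hy₀ (hy i)) (L.abs_div_le_scale d i)
      (abs_nonneg _) (by positivity)
  have hE : ‖L.B d.fst - L.A z‖ ≤ (K + K * (m * (μ / y₀))) * ‖L.scale d‖ := by
    refine (norm_sub_le _ _).trans ?_
    rw [add_mul]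
    refine add_le_add ?_ ?_
    · exact (L.B.le_opNorm _).trans
        (mul_le_mul hL.B (L.norm_fst_le_scale d) (norm_nonneg _) (by linarith))
    · rw [mul_assoc K]
      exact (L.A.le_opNorm _).trans (mul_le_mul hL.A hznorm (norm_nonneg _) (by linarith))
  have hinner : ⟪L.tangDir μ N d, u⟫_ℝ = ‖v‖ ^ 2 + ⟪L.B d.fst - L.A z, v⟫_ℝ := by
    unfold tangDir
    rw [ContinuousLinearMap.adjoint_inner_left, WithLp.prod_inner_apply]
    change ⟪-(L.gradf + L.B d.fst), (N u).fst⟫_ℝ + ⟪(WithLp.toLp 2 fun i =>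
      μ * (1 / L.y i - d.snd i / L.y i ^ 2) : Vec m), (N u).snd⟫_ℝ = _
    rw [hsnd, hu', map_neg, neg_neg, ContinuousLinearMap.adjoint_inner_right, inner_neg_neg,
      ← inner_add_left, ← real_inner_self_eq_norm_sq, ← inner_add_left]
    congr 1
    have h1 : (WithLp.toLp 2 fun i => μ * (1 / L.y i - d.snd i / L.y i ^ 2) : Vec m) =
        (μ • WithLp.toLp 2 fun i => (L.y i)⁻¹) - z := by
      ext i
      simp [hz]
      ring
    rw [h1, map_sub, hv, dualResidual]
    abel
  have h1 := real_inner_le_norm (L.tangDir μ N d) u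
  have h2 := (abs_le.1 (abs_real_inner_le_norm (L.B d.fst - L.A z) v)).1
  rcases (norm_nonneg v).eq_or_lt with h0 | h0
  · rw [← h0]
    positivity
  refine le_of_mul_le_mul_right ?_ h0
  have h3 := mul_le_mul_of_nonneg_left hunorm (norm_nonneg (L.tangDir μ N d))
  have h4 := mul_le_mul_of_nonneg_right hE h0.le
  nlinarith

end Local

namespace Seqs

variable {S : Seqs n m} {f : Vec n → ℝ} {g : Vec n → Vec m}
  {P : Params} {μ νinit : ℝ}

namespace IsRun

variable (hS : S.IsRun f g P μ νinit)

include hS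

theorem exists_mul_min_le_npred (h2 : S.A2 f g) (hμ : 0 < μ) (hsv : S.JacobianBoundedAway g) :
    ∃ κ > 0, ∀ k, κ * min ‖g (S.x k) + S.y k‖ (S.stepScale k) ≤
      (S.loc f g k).npred P.ξ (S.nStep k) := by
  obtain ⟨K, hK⟩ := hS.exists_boundedBy h2 hμ
  obtain ⟨γ, hγ, hJ⟩ := exists_le_scaledAdj (f := f) hsv
  obtain ⟨κ, hκ, h⟩ := Local.exists_mul_min_le_npred n m (hK 0).one_le hγ P.ξ_pos P.ξ_lt_one P.τ_pos
    P.τ_lt_one P.γn_pos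
  exact ⟨κ, hκ, fun k => h (S.loc f g k) _ _ (hS.y_pos k) (hK k) (hJ k) (hS.stepScale_pos k)
    (hS.sigma_mul_stepScale_sq k) (hS.normal_cauchy k)⟩

/-- The iterates become feasible. -/
theorem tendsto_norm_res (hf : ContDiff ℝ 1 f) (hg : ContDiff ℝ 1 g) (h1 : S.A1 f g)
    (h2 : S.A2 f g) (hμ : 0 < μ) (hsv : S.JacobianBoundedAway g) :
    Tendsto (fun k => ‖g (S.x k) + S.y k‖) atTop (𝓝 0) := by
  obtain ⟨K, hK⟩ := hS.exists_boundedBy h2 hμ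
  obtain ⟨κ, hκ, hκn⟩ := hS.exists_mul_min_le_npred h2 hμ hsv
  refine hS.tendsto_zero_of_le_pred hf hg h2 hμ _ (fun _ => norm_nonneg _)
    (fun k hx hy => by rw [hx, hy]) ?_ ?_
  · obtain ⟨X, -, -, hxX, -, -, -, ⟨Lg, hLg⟩, -⟩ := h1
    refine ⟨Lg + K, 0, fun k _ hx hy => (abs_norm_sub_norm_le _ _).trans ?_⟩
    have e1 : g (S.x (k + 1)) + S.y (k + 1) - (g (S.x k) + S.y k) =
        (g (S.x (k + 1)) - g (S.x k)) + (S.step k).snd := by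
      rw [hy]
      abel
    rw [e1, add_mul]
    refine (norm_add_le _ _).trans (add_le_add ?_ ?_)
    · refine (hLg.norm_sub_le (hxX _) (hxX _)).trans ?_
      rw [hx, add_sub_cancel_left]
      exact mul_le_mul_of_nonneg_left ((S.loc f g k).norm_fst_le_scale _) Lg.2
    · exact ((S.loc f g k).norm_snd_le_scale (hS.y_pos k) _).trans
        (mul_le_mul_of_nonneg_right (hK k).y (norm_nonneg _))
  · intro ε hε
    have hν0 := hS.nu_pos 0
    have hδ := P.δ_pos
    have hε1 : 0 < min ε 1 := lt_min hε one_pos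
    refine ⟨S.ν 0 / (1 + S.ν 0) * (P.δ * (κ * min ε 1)), by positivity, 0, fun k _ hk => ?_⟩
    refine le_trans ?_ (hS.le_pred k).1
    have hs := hS.stepScale_pos k
    have hν := hS.nu_pos k
    have e1 : S.ν 0 / (1 + S.ν 0) * (1 + S.ν k) ≤ S.ν k := by
      rw [div_mul_eq_mul_div, div_le_iff₀ (by positivity)]
      have := hS.nu_mono (Nat.zero_le k)
      linarith
    have e2 : min ε 1 * min 1 (S.stepScale k) ≤ min ‖g (S.x k) + S.y k‖ (S.stepScale k) := by
      have hm : 0 < min 1 (S.stepScale k) := lt_min one_pos hs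
      refine le_min ?_ ?_
      · calc min ε 1 * min 1 (S.stepScale k) ≤ ε * 1 :=
              mul_le_mul (min_le_left _ _) (min_le_left _ _) hm.le hε.le
          _ ≤ _ := by rw [mul_one]; exact hk
      · calc min ε 1 * min 1 (S.stepScale k) ≤ 1 * S.stepScale k :=
              mul_le_mul (min_le_right _ _) (min_le_right _ _) hm.le zero_le_one
          _ = _ := one_mul _
    have e3 : κ * (min ε 1 * min 1 (S.stepScale k)) ≤
        (S.loc f g k).npred P.ξ (S.nStep k) :=
      (mul_le_mul_of_nonneg_left e2 hκ.le).trans (hκn k)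
    have hm : 0 < min 1 (S.stepScale k) := lt_min one_pos hs
    calc S.ν 0 / (1 + S.ν 0) * (P.δ * (κ * min ε 1)) * ((1 + S.ν k) * min 1 (S.stepScale k))
        = (S.ν 0 / (1 + S.ν 0) * (1 + S.ν k)) *
          (P.δ * (κ * (min ε 1 * min 1 (S.stepScale k)))) := by ring
      _ ≤ S.ν k * (P.δ * (S.loc f g k).npred P.ξ (S.nStep k)) := by gcongr

/-- Eventually the normal steps lie in the range space. -/
theorem eventually_mem_rangeSpace (hf : ContDiff ℝ 1 f) (hg : ContDiff ℝ 1 g) (h1 : S.A1 f g)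
    (h2 : S.A2 f g) (hμ : 0 < μ) (hsv : S.JacobianBoundedAway g) :
    ∀ᶠ k in atTop, S.nStep k ∈ (S.loc f g k).rangeSpace := by
  obtain ⟨γ, hγ, hJ⟩ := exists_le_scaledAdj (f := f) hsv
  have hpos : 0 < γ * (P.ξ * P.τ) / 2 := by
    have := P.ξ_pos
    have := P.τ_pos
    positivity
  filter_upwards [(hS.tendsto_norm_res hf hg h1 h2 hμ hsv).eventually (gt_mem_nhds hpos)] with k hk
  refine (S.loc f g k).mem_rangeSpace_of_norm_res_lt (hS.y_pos k) (hJ k) hγ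
    ((S.loc f g k).sigmaTilde_pos P.ξ_pos (hS.σ_pos k)) (hS.range_space k) ?_
  change 2 * ‖g (S.x k) + S.y k‖ ≤ _
  linarith

theorem tendsto_norm_scale_nStep (hf : ContDiff ℝ 1 f) (hg : ContDiff ℝ 1 g) (h1 : S.A1 f g)
    (h2 : S.A2 f g) (hμ : 0 < μ) (hsv : S.JacobianBoundedAway g) :
    Tendsto (fun k => ‖(S.loc f g k).scale (S.nStep k)‖) atTop (𝓝 0) := by
  obtain ⟨γ, hγ, hJ⟩ := exists_le_scaledAdj (f := f) hsv
  have hlim : Tendsto (fun k => 2 / γ * ‖g (S.x k) + S.y k‖) atTop (𝓝 0) := by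
    simpa using (hS.tendsto_norm_res hf hg h1 h2 hμ hsv).const_mul (2 / γ)
  refine squeeze_zero' (Eventually.of_forall fun _ => norm_nonneg _) ?_ hlim
  filter_upwards [hS.eventually_mem_rangeSpace hf hg h1 h2 hμ hsv] with k hk
  exact (S.loc f g k).norm_scale_le_two_div_mul (hS.y_pos k) (hJ k) hγ P.ξ_pos (hS.σ_pos k) hk
    (hS.npred_nonneg k)

/-- The penalty parameter is eventually constant. -/
theorem exists_nu_eq (hf : ContDiff ℝ 1 f) (hg : ContDiff ℝ 1 g) (h1 : S.A1 f g)
    (h2 : S.A2 f g) (hμ : 0 < μ) (hsv : S.JacobianBoundedAway g) :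
    ∃ ν K₀, ∀ k ≥ K₀, S.ν k = ν := by
  obtain ⟨K, hK⟩ := hS.exists_boundedBy h2 hμ
  obtain ⟨κ, hκ, hκn⟩ := hS.exists_mul_min_le_npred h2 hμ hsv
  obtain ⟨γ, hγ, hJ⟩ := exists_le_scaledAdj (f := f) hsv
  obtain ⟨Q, hQ⟩ := Local.exists_nuTilde_le n m (hK 0).one_le hγ hμ P.ξ_pos P.ξ_lt_one
    P.δ_lt_one hκ
  obtain ⟨K₁, hK₁⟩ := eventually_atTop.1 (hS.eventually_mem_rangeSpace hf hg h1 h2 hμ hsv)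
  have hnt : ∀ k ≥ K₁, S.nuTilde f g P μ k ≤ Q := fun k hk =>
    hQ (S.loc f g k) _ _ _ (hS.y_pos k) (hK k) (hJ k) (hS.stepScale_pos k)
      (hS.sigma_mul_stepScale_sq k) (hK₁ k hk) (hS.tang_feasible k).1 (hS.tpred_nonneg k) (hκn k)
  have hbd : ∀ j, S.ν (K₁ + j) ≤ max (S.ν K₁) (3 / 2 * Q) := by
    intro j
    induction j with
    | zero => exact le_max_left _ _
    | succ j ih =>
      have e1 := hS.ν_succ (K₁ + j)
      have e2 := hnt (K₁ + j + 1) (by omega)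
      have e3 := hS.nu_pos (K₁ + j)
      rw [penaltyUpdate] at e1
      rw [← add_assoc, e1]
      split_ifs with h
      · exact ih
      · rw [not_le] at h
        exact max_le ((e2.trans (by linarith)).trans (le_max_right _ _))
          (le_trans (by linarith) (le_max_right _ _))
  have hbdd : BddAbove (Set.range S.ν) := by
    refine ⟨max (S.ν K₁) (3 / 2 * Q), ?_⟩
    rintro _ ⟨k, rfl⟩
    exact (hS.nu_mono (Nat.le_add_left k K₁)).trans (hbd k)
  have hl := tendsto_atTop_ciSup hS.nu_mono hbdd
  have hdiff : Tendsto (fun k => S.ν (k + 1) - S.ν k) atTop (𝓝 0) := by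
    simpa using (hl.comp (tendsto_add_atTop_nat 1)).sub hl
  have hν0 := hS.nu_pos 0
  obtain ⟨K₂, hK₂⟩ := eventually_atTop.1
    (hdiff.eventually (gt_mem_nhds (by positivity : 0 < S.ν 0 / 2)))
  refine ⟨S.ν K₂, K₂, fun k hk => ?_⟩
  induction k, hk using Nat.le_induction with
  | base => rfl
  | succ k hk ih =>
    rw [← ih]
    -- an increase is by at least the fixed amount `ν 0 / 2`
    refine (hS.nu_succ k).resolve_right fun h => ?_
    have e1 := hK₂ k hk
    have e2 := hS.nu_mono (Nat.zero_le k)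
    linarith

/-- Once the penalty parameter is constant, the barrier term keeps the slacks away from zero. -/
theorem exists_le_y (h2 : S.A2 f g) (hμ : 0 < μ) {ν : ℝ} {K₀ : ℕ} (hν : ∀ k ≥ K₀, S.ν k = ν) :
    ∃ y₀ > 0, ∀ k ≥ K₀, ∀ i, y₀ ≤ S.y k i := by
  obtain ⟨K, hK⟩ := hS.exists_boundedBy h2 hμ
  obtain ⟨⟨Cf, hCf⟩, -⟩ := h2
  have hν0 : 0 < ν := hν K₀ le_rfl ▸ hS.nu_pos K₀
  have hmono : ∀ k ≥ K₀,
      merit f g μ ν (S.x k) (S.y k) ≤ merit f g μ ν (S.x K₀) (S.y K₀) := by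
    intro k hk
    induction k, hk using Nat.le_induction with
    | base => exact le_rfl
    | succ k hk ih =>
      have := (hS.merit_succ_le k).1
      rw [hν k hk] at this
      exact this.trans ih
  set R := (merit f g μ ν (S.x K₀) (S.y K₀) - Cf) / μ with hR
  refine ⟨Real.exp (K - (m * K + R)), Real.exp_pos _, fun k hk i => ?_⟩
  rw [← Real.le_log_iff_exp_le (hS.y_pos k i)]
  have e1 : -∑ j, Real.log (S.y k j) ≤ R := by
    rw [hR, le_div_iff₀ hμ]
    have := hmono k hk
    have e2 : f (S.x k) - μ * ∑ j, Real.log (S.y k j) ≤ merit f g μ ν (S.x k) (S.y k) := by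
      rw [merit]
      have : 0 ≤ ν * ‖g (S.x k) + S.y k‖ := by positivity
      linarith
    linarith [hCf k]
  have e3 : ∀ j, 0 ≤ K - Real.log (S.y k j) := fun j => by
    have h3 := Real.log_le_sub_one_of_pos (hS.y_pos k j)
    have h4 := (le_abs_self _).trans ((abs_apply_le_norm (S.y k) j).trans (hK k).y)
    linarith
  have e4 := Finset.single_le_sum (f := fun j => K - Real.log (S.y k j)) (fun j _ => e3 j)
    (Finset.mem_univ i)
  rw [Finset.sum_sub_distrib] at e4
  simp only [Finset.sum_const, Finset.card_univ, Fintype.card_fin, nsmul_eq_mul] at e4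
  linarith

/-- The predicted reduction is at least a fraction of the tangential one: a normal step that harms
the tangential progress is paid for by its own normal decrease. -/
theorem exists_mul_tpred_le_pred (hf : ContDiff ℝ 1 f) (hg : ContDiff ℝ 1 g) (h1 : S.A1 f g)
    (h2 : S.A2 f g) (hμ : 0 < μ) (hsv : S.JacobianBoundedAway g) :
    ∃ κ > 0, ∀ᶠ k in atTop, κ * (S.loc f g k).tpred μ (S.nStep k) (S.tStep k) ≤
      (S.loc f g k).pred μ (S.ν k) (S.step k) := by
  obtain ⟨K, hK⟩ := hS.exists_boundedBy h2 hμ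
  obtain ⟨κ, hκ, hκn⟩ := hS.exists_mul_min_le_npred h2 hμ hsv
  obtain ⟨γ, hγ, hJ⟩ := exists_le_scaledAdj (f := f) hsv
  have hK1 := (hK 0).one_le
  have hδ := P.δ_pos
  have hν0 := hS.nu_pos 0
  set C := 2 / γ + 6 * K with hC
  have hC0 : 0 < C := by positivity
  set D := (K + μ * (m + 1)) * (1 + 1) with hD
  have hD0 : 0 < D := by positivity
  set G := D * C / (κ * (S.ν 0 * P.δ)) with hG
  have hG0 : 0 < G := by positivity
  refine ⟨1 / (1 + G), by positivity, ?_⟩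
  filter_upwards [hS.eventually_mem_rangeSpace hf hg h1 h2 hμ hsv,
    (hS.tendsto_norm_scale_nStep hf hg h1 h2 hμ hsv).eventually (gt_mem_nhds one_pos)] with k hk hk1
  set L := S.loc f g k with hL
  have hn := hS.npred_nonneg k
  have hN0 : 0 ≤ ‖L.scale (S.nStep k)‖ := norm_nonneg _
  have hNn : κ * ‖L.scale (S.nStep k)‖ ≤ C * L.npred P.ξ (S.nStep k) :=
    L.mul_norm_scale_le_npred (hS.y_pos k) (hK k) (hJ k) hγ P.ξ_pos P.ξ_lt_one hκ
      (hS.stepScale_pos k) (hS.sigma_mul_stepScale_sq k) hk (hκn k)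
  have hχ : -L.chi μ (S.nStep k) ≤ D * ‖L.scale (S.nStep k)‖ := by
    refine (neg_le_abs _).trans ((L.abs_chi_le (hK k) hμ _).trans ?_)
    rw [hD]
    gcongr
  obtain ⟨p1, p2⟩ := hS.le_pred k
  have hνn : S.ν 0 * (P.δ * L.npred P.ξ (S.nStep k)) ≤ L.pred μ (S.ν k) (S.step k) :=
    le_trans (mul_le_mul_of_nonneg_right (hS.nu_mono (Nat.zero_le k)) (by positivity)) p1
  have e1 : D * ‖L.scale (S.nStep k)‖ ≤ G * L.pred μ (S.ν k) (S.step k) := by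
    rw [hG, div_mul_eq_mul_div, le_div_iff₀ (by positivity)]
    calc D * ‖L.scale (S.nStep k)‖ * (κ * (S.ν 0 * P.δ))
        = D * (S.ν 0 * P.δ) * (κ * ‖L.scale (S.nStep k)‖) := by ring
      _ ≤ D * (S.ν 0 * P.δ) * (C * L.npred P.ξ (S.nStep k)) := by gcongr
      _ = D * C * (S.ν 0 * (P.δ * L.npred P.ξ (S.nStep k))) := by ring
      _ ≤ _ := by gcongr
  have e2 : 0 ≤ S.ν k * (1 / 2 * L.npred P.ξ (S.nStep k)) := by
    have := hS.nu_pos k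
    positivity
  rw [div_mul_eq_mul_div, one_mul, div_le_iff₀ (by positivity)]
  linarith

/-- While the slacks are bounded away from zero, the dual residual is Lipschitz along the
iterates. -/
theorem exists_abs_norm_dualResidual_sub_le (h1 : S.A1 f g) (h2 : S.A2 f g) (hμ : 0 < μ) {y₀ : ℝ}
    {K₀ : ℕ} (hy₀ : 0 < y₀) (hy : ∀ k ≥ K₀, ∀ i, y₀ ≤ S.y k i) :
    ∃ C, ∃ K₁, ∀ k ≥ K₁, S.x (k + 1) = S.x k + (S.step k).fst →
      S.y (k + 1) = S.y k + (S.step k).snd →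
      |‖(S.loc f g (k + 1)).dualResidual μ‖ - ‖(S.loc f g k).dualResidual μ‖| ≤
        C * ‖(S.loc f g k).scale (S.step k)‖ := by
  obtain ⟨K, hK⟩ := hS.exists_boundedBy h2 hμ
  have hK1 := (hK 0).one_le
  obtain ⟨X, -, -, hxX, -, -, ⟨Lf, hLf⟩, -, ⟨LA, hLA⟩⟩ := h1
  refine ⟨Lf + LA * (μ * (m * y₀⁻¹)) + K * (μ * (m * y₀⁻¹)), K₀, fun k hk hx hyk => ?_⟩
  refine (abs_norm_sub_norm_le _ _).trans ?_
  have hdx := (S.loc f g k).norm_fst_le_scale (S.step k)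
  set D := ‖(S.loc f g k).scale (S.step k)‖ with hD
  set z : ℕ → Vec m := fun k => WithLp.toLp 2 fun i => (S.y k i)⁻¹ with hz
  have hz1 : ‖z (k + 1)‖ ≤ m * y₀⁻¹ := norm_le_card_mul _ fun i => by
    have hyi := hy (k + 1) (by omega) i
    change |(S.y (k + 1) i)⁻¹| ≤ _
    rw [abs_of_pos (inv_pos.2 (hy₀.trans_le hyi))]
    exact inv_anti₀ hy₀ hyi
  have hz2 : ‖z (k + 1) - z k‖ ≤ m * (y₀⁻¹ * D) := norm_le_card_mul _ fun i => by
    have hyi := hy (k + 1) (by omega) i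
    have p1 := hS.y_pos (k + 1) i
    have p2 := hS.y_pos k i
    have e1 : (z (k + 1) - z k) i =
        -((S.y (k + 1) i)⁻¹ * ((S.step k).snd i / S.y k i)) := by
      change (S.y (k + 1) i)⁻¹ - (S.y k i)⁻¹ = _
      have e2 : (S.step k).snd i = S.y (k + 1) i - S.y k i := by
        rw [hyk, PiLp.add_apply, add_sub_cancel_left]
      rw [e2]
      field_simp
      ring
    rw [e1, abs_neg, abs_mul, abs_of_pos (inv_pos.2 p1)]
    exact mul_le_mul (inv_anti₀ hy₀ hyi) ((S.loc f g k).abs_div_le_scale _ i) (abs_nonneg _)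
      (by positivity)
  have e1 : gradient f (S.x (k + 1)) + conGrad g (S.x (k + 1)) (μ • z (k + 1)) -
      (gradient f (S.x k) + conGrad g (S.x k) (μ • z k)) =
      (gradient f (S.x (k + 1)) - gradient f (S.x k)) +
      (conGrad g (S.x (k + 1)) - conGrad g (S.x k)) (μ • z (k + 1)) +
      conGrad g (S.x k) (μ • (z (k + 1) - z k)) := by
    rw [sub_apply, smul_sub, map_sub]
    abel
  have hdx' : ‖S.x (k + 1) - S.x k‖ ≤ D := by rwa [hx, add_sub_cancel_left]
  have e2 : ‖gradient f (S.x (k + 1)) - gradient f (S.x k)‖ ≤ Lf * D :=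
    (hLf.norm_sub_le (hxX _) (hxX _)).trans (mul_le_mul_of_nonneg_left hdx' Lf.2)
  have e3 : ‖(conGrad g (S.x (k + 1)) - conGrad g (S.x k)) (μ • z (k + 1))‖ ≤
      LA * (μ * (m * y₀⁻¹)) * D := by
    refine (ContinuousLinearMap.le_opNorm _ _).trans ?_
    rw [norm_smul, Real.norm_of_nonneg hμ.le]
    have := (hLA.norm_sub_le (hxX (k + 1)) (hxX k)).trans (mul_le_mul_of_nonneg_left hdx' LA.2)
    calc _ ≤ LA * D * (μ * (m * y₀⁻¹)) := by gcongr
      _ = _ := by ring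
  have e4 : ‖conGrad g (S.x k) (μ • (z (k + 1) - z k))‖ ≤ K * (μ * (m * y₀⁻¹)) * D := by
    refine (ContinuousLinearMap.le_opNorm _ _).trans ?_
    rw [norm_smul, Real.norm_of_nonneg hμ.le]
    have : ‖conGrad g (S.x k)‖ ≤ K := (hK k).A
    calc _ ≤ K * (μ * (m * (y₀⁻¹ * D))) := by gcongr
      _ = _ := by ring
  change ‖gradient f (S.x (k + 1)) + conGrad g (S.x (k + 1)) (μ • z (k + 1)) -
    (gradient f (S.x k) + conGrad g (S.x k) (μ • z k))‖ ≤ _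
  rw [e1, add_mul, add_mul]
  exact (norm_add₃_le).trans (add_le_add (add_le_add e2 e3) e4)

/-- The predicted reduction is sufficient where the dual residual is bounded away from zero. -/
theorem exists_mul_min_le_pred (hf : ContDiff ℝ 1 f) (hg : ContDiff ℝ 1 g) (h1 : S.A1 f g)
    (h2 : S.A2 f g) (h3 : S.A3) (hμ : 0 < μ) (hsv : S.JacobianBoundedAway g) {ν y₀ : ℝ}
    {K₁ : ℕ} (hν : ∀ k ≥ K₁, S.ν k = ν) (hy₀ : 0 < y₀) (hy : ∀ k ≥ K₁, ∀ i, y₀ ≤ S.y k i)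
    {ε : ℝ} (hε : 0 < ε) :
    ∃ κ > 0, ∃ K₀, ∀ k ≥ K₀, ε ≤ ‖(S.loc f g k).dualResidual μ‖ →
      κ * ((1 + S.ν k) * min 1 (S.stepScale k)) ≤ (S.loc f g k).pred μ (S.ν k) (S.step k) := by
  obtain ⟨K, hK⟩ := hS.exists_boundedBy h2 hμ
  have hK1 := (hK 0).one_le
  obtain ⟨γN, hγN, hN⟩ := h3
  obtain ⟨κ₁, hκ₁, hpt⟩ := hS.exists_mul_tpred_le_pred hf hg h1 h2 hμ hsv
  set R := γN * (1 + K) with hR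
  have hR0 : 0 < R := by positivity
  set E := K + K * (m * (μ / y₀)) with hE
  have hE0 : 0 < E := by positivity
  obtain ⟨κ₂, hκ₂, htp⟩ := Local.exists_mul_min_le_tpred n m (ξ := P.ξ) hK1 hμ P.ξ_lt_one P.τ_pos
    P.γt_pos hγN hy₀ zero_le_one (by positivity : 0 < ε / (2 * R))
  have hν0 : 0 < ν := hν K₁ le_rfl ▸ hS.nu_pos K₁
  refine ⟨κ₁ * κ₂ / (1 + ν), by positivity, ?_⟩
  have hn := hS.tendsto_norm_scale_nStep hf hg h1 h2 hμ hsv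
  obtain ⟨K₂, hK₂⟩ := Filter.eventually_atTop.1 ((hpt.and (hn.eventually (gt_mem_nhds
    (by positivity : 0 < min 1 (ε / (2 * E)))))).and (Filter.eventually_ge_atTop K₁))
  refine ⟨K₂, fun k hk hθk => ?_⟩
  obtain ⟨⟨p1, p2⟩, p3⟩ := hK₂ k hk
  have p4 := (p2.trans_le (min_le_left _ _)).le
  have p5 := p2.trans_le (min_le_right _ _)
  have hker : ∀ w, jac (S.loc f g k).A (S.N k w) = 0 := fun w => by
    have : S.N k w ∈ LinearMap.ker (jac (conGrad g (S.x k))) :=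
      hS.N_range k ▸ ⟨w, rfl⟩
    exact this
  have hNlow : ∀ w, γN⁻¹ * ‖w‖ ≤ ‖S.N k w‖ := fun w =>
    le_norm_of_le_singularValues (S.N k).toLinearMap (inv_pos.2 hγN).le
      (fun i hi => (hN k).2 i (by simpa using hi)) w
  have e1 := (S.loc f g k).norm_dualResidual_le (hK k) hμ hy₀ (hy k p3) hγN hNlow hker (S.nStep k)
  have e2 : ε ≤ ‖(S.loc f g k).dualResidual μ‖ := hθk
  have e3 : ε / (2 * R) ≤ ‖(S.loc f g k).tangDir μ (S.N k) (S.nStep k)‖ := by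
    rw [div_le_iff₀ (by positivity)]
    rw [lt_div_iff₀ (by positivity)] at p5
    linarith
  have e4 := htp (S.loc f g k) (S.stepScale k) (S.N k) (S.nStep k) (S.tStep k) (hy k p3) (hK k)
    (hS.stepScale_pos k) (hS.sigma_mul_stepScale_sq k) (hN k).1 p4 (hS.normal_feasible k) e3
    (hS.tang_cauchy k)
  rw [hν k p3] at p1 ⊢
  refine le_trans ?_ p1
  have e5 := mul_le_mul_of_nonneg_left e4 hκ₁.le
  refine le_trans (le_of_eq ?_) e5
  field_simp

theorem tendsto_norm_dualResidual (hf : ContDiff ℝ 1 f) (hg : ContDiff ℝ 1 g) (h1 : S.A1 f g)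
    (h2 : S.A2 f g) (h3 : S.A3) (hμ : 0 < μ) (hsv : S.JacobianBoundedAway g) :
    Tendsto (fun k => ‖(S.loc f g k).dualResidual μ‖) atTop (𝓝 0) := by
  obtain ⟨ν, K₁, hν⟩ := hS.exists_nu_eq hf hg h1 h2 hμ hsv
  obtain ⟨y₀, hy₀, hy⟩ := hS.exists_le_y h2 hμ hν
  exact hS.tendsto_zero_of_le_pred hf hg h2 hμ _ (fun _ => norm_nonneg _)
    (fun k hx hy => by simp only [Local.dualResidual, loc, hx, hy])
    (hS.exists_abs_norm_dualResidual_sub_le h1 h2 hμ hy₀ hy)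
    (fun ε hε => hS.exists_mul_min_le_pred hf hg h1 h2 h3 hμ hsv hν hy₀ hy hε)

end IsRun

end Seqs

end ARCBIP

theorem theorem2 {n m : ℕ} (f : ARCBIP.Vec n → ℝ) (g : ARCBIP.Vec n → ARCBIP.Vec m)
    (hf : ContDiff ℝ 1 f) (hg : ContDiff ℝ 1 g)
    (P : ARCBIP.Params) (μ νinit : ℝ) (hμ : 0 < μ)
    (S : ARCBIP.Seqs n m) (hS : S.IsRun f g P μ νinit)
    (h1 : S.A1 f g) (h2 : S.A2 f g) (h3 : S.A3) (hsv : S.JacobianBoundedAway g) :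
    Filter.Tendsto
      (fun k => gradient f (S.x k) +
        ARCBIP.conGrad g (S.x k) (μ • WithLp.toLp 2 fun i => (S.y k i)⁻¹))
      Filter.atTop (nhds 0) :=
  tendsto_zero_iff_norm_tendsto_zero.2 (hS.tendsto_norm_dualResidual hf hg h1 h2 h3 hμ hsv)
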